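/- **Corollary 5.6 (asymptotic Bernstein–von Mises theorem for a discrete probability distribution).** For each $n$ let $d_n\ge 1$ be an integer and let $$\Theta_n=\Big\{\theta\in\mathbb R^{d_n}:\ \theta_j>0\ (1\le j\le d_n),\ \textstyle\sum_{j=1}^{d_n}\theta_j<1\Big\}.$$ For $\theta\in\Theta_n$ put $\theta_0=1-\sum_{j=1}^{d_n}\theta_j$, so that $(\theta_0,\dots,\theta_{d_n})$ is a strictly positive pmf on $d_n+1$ states. Let $\theta^*_n\in\Theta_n$ be ground truth pmfs, let $\theta^*_{\min,n}=\min_{0\le j\le d_n}(\theta^*_n)_j$, and let $N=(N_0,\dots,N_{d_n})\sim\mathrm{Multi}(n,\theta^*_n)$ be the counts of $n$ independent draws from $\theta^*_n$. Let $$L_n(\theta)=\prod_{j=0}^{d_n}\theta_j^{N_j},\qquad \ell_n=-\tfrac1n\log L_n,\qquad \ell^*_n(\theta)=\mathbb E[\ell_n(\theta)],\qquad F^*_n=\nabla^2\ell^*_n(\theta^*_n),$$ where the derivatives are in the free parameters $\theta_1,\dots,\theta_{d_n}$. Let $\rho_n:\mathbb R^{d_n}\to[0,\infty)$ be a measurable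 prior density (not necessarily normalized) with $\rho_n(\theta^*_n)>0$. The posterior $\pi_n$ is the probability measure on $\Theta_n$ with Lebesgue density proportional to $e^{-n\ell_n}\rho_n$. When $\ell_n$ has a unique minimizer $\hat\theta_n$ over $\Theta_n$ (the maximum likelihood estimator), let $\gamma^*_n=\mathcal N(\hat\theta_n,(nF^*_n)^{-1})$. For $s\ge0$ let $U^*_n(s)=\{\theta\in\mathbb R^{d_n}:\ ((\theta-\theta^*_n)^{\top}F^*_n(\theta-\theta^*_n))^{1/2}\le s\sqrt{d_n/n}\}$ and $$\delta^*_{01n}(s)=\sup_{\theta\in U^*_n(s)}\|\nabla\log\rho_n(\theta)\|_{F^*_n},\qquad M^*_{0n}=\frac1{d_n}\log\sup_{\theta\in\Theta_n}\frac{\rho_n(\theta)}{\rho_n(\theta^*_n)},$$ where $\|g\|_{F}=\sup\{g^{\top}u:\ u^{\top}Fu=1\}=|F^{-1/2}g|$, and $\delta^*_{01n}(s)=\infty$ if $\rho_n$ is not $C^1$ (in a neighborhood of each point) or not strictly positive on $U^*_n(s)$. Suppose that, as $n\to\infty$, $$M^*_{0n}=O(1),\qquad \delta^*_{01n}(s)=o(\sqrt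 n)\ \text{ for each } s\ge0,\qquad \frac{d_n^2}{n\,\theta^*_{\min,n}}\to0 .$$ Then $\mathrm{TV}(\pi_n,\gamma^*_n)\to0$ with probability tending to $1$, where $\mathrm{TV}(\mu,\nu)=\sup_A|\mu(A)-\nu(A)|$. That is, for every $\varepsilon>0$, the probability that $\pi_n$ is well defined, that the maximum likelihood estimator exists and is unique, and that $\mathrm{TV}(\pi_n,\gamma^*_n)\le\varepsilon$, tends to $1$ as $n\to\infty$. -/

import Mathlib

open MeasureTheory ProbabilityTheory Filter Topology
open scoped ENNReal Matrix

namespace PmfBvM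

noncomputable section

/-- The parameter space: the probabilities of states `1, …, d` of a strictly positive pmf on
the `d + 1` states `0, 1, …, d`. -/
def Theta (d : ℕ) : Set (EuclideanSpace ℝ (Fin d)) :=
  {θ | (∀ j, 0 < θ j) ∧ ∑ j, θ j < 1}

/-- The full vector `(θ₀, θ₁, …, θ_d)`, where `θ₀ = 1 - ∑ θ_j`. -/
def fullPmf {d : ℕ} (θ : EuclideanSpace ℝ (Fin d)) : Fin (d + 1) → ℝ :=
  Fin.cons (1 - ∑ j, θ j) (fun j => θ j)

/-- The smallest of the `d + 1` probabilities. -/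
def thetaMin {d : ℕ} (θ : EuclideanSpace ℝ (Fin d)) : ℝ :=
  ⨅ j, fullPmf θ j

/-- The law on the `d + 1` states with probabilities `θ₀, …, θ_d`. -/
def categorical {d : ℕ} (θ : EuclideanSpace ℝ (Fin d)) : Measure (Fin (d + 1)) :=
  ∑ j, ENNReal.ofReal (fullPmf θ j) • Measure.dirac j

/-- The counts `(N₀, …, N_d)` of the states in a sample of size `n`. -/
def counts {d n : ℕ} (x : Fin n → Fin (d + 1)) : Fin (d + 1) → ℕ :=
  fun j => (Finset.univ.filter (fun i => x i = j)).card

/-- `Multi(n, θ)`: the law of the counts of `n` independent draws from `θ`. -/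
def multinomial {d : ℕ} (n : ℕ) (θ : EuclideanSpace ℝ (Fin d)) : Measure (Fin (d + 1) → ℕ) :=
  (Measure.pi (fun _ : Fin n => categorical θ)).map counts

/-- The likelihood `L(θ) = ∏ θ_j ^ N_j`. -/
def likelihood {d : ℕ} (N : Fin (d + 1) → ℕ) (θ : EuclideanSpace ℝ (Fin d)) : ℝ :=
  ∏ j, fullPmf θ j ^ N j

/-- The negative normalized log likelihood `ℓ = -(1/n) log L`. -/
def nll {d : ℕ} (n : ℕ) (N : Fin (d + 1) → ℕ) (θ : EuclideanSpace ℝ (Fin d)) : ℝ :=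
  -(1 / (n : ℝ)) * Real.log (likelihood N θ)

/-- The negative population log likelihood `ℓ*(θ) = 𝔼 ℓ(θ)`, for data with law
`Multi(n, θs)`. -/
def popNll {d : ℕ} (n : ℕ) (θs θ : EuclideanSpace ℝ (Fin d)) : ℝ :=
  ∫ N, nll n N θ ∂(multinomial n θs)

/-- The matrix of second partial derivatives of `f` at `x`. -/
def hessian {d : ℕ} (f : EuclideanSpace ℝ (Fin d) → ℝ) (x : EuclideanSpace ℝ (Fin d)) :
    Matrix (Fin d) (Fin d) ℝ :=
  Matrix.of fun i j =>
    iteratedFDeriv ℝ 2 f x ![EuclideanSpace.single i 1, EuclideanSpace.single j 1]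

/-- The Fisher information matrix `F* = ∇²ℓ*(θ*)`. -/
def fisher {d : ℕ} (n : ℕ) (θs : EuclideanSpace ℝ (Fin d)) : Matrix (Fin d) (Fin d) ℝ :=
  hessian (popNll n θs) θs

/-- The weighted norm `|u|_A = |A^{1/2} u| = (uᵀ A u)^{1/2}` of a vector. -/
def wNorm {d : ℕ} (A : Matrix (Fin d) (Fin d) ℝ) (u : EuclideanSpace ℝ (Fin d)) : ℝ :=
  √(u.ofLp ⬝ᵥ (A *ᵥ u.ofLp))

/-- The weighted norm `‖S‖_A = sup {S u : |u|_A = 1}` of a linear form. -/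
def dualNorm {d : ℕ} (A : Matrix (Fin d) (Fin d) ℝ) (S : EuclideanSpace ℝ (Fin d) →L[ℝ] ℝ) :
    ℝ≥0∞ :=
  ⨆ (u : EuclideanSpace ℝ (Fin d)) (_ : wNorm A u = 1), ENNReal.ofReal (S u)

/-- The neighbourhood `U*(s) = {θ : |θ - θ*|_{F*} ≤ s √(d/n)}`, a subset of all of `ℝ^d`. -/
def nbhd {d : ℕ} (n : ℕ) (θs : EuclideanSpace ℝ (Fin d)) (s : ℝ) :
    Set (EuclideanSpace ℝ (Fin d)) :=
  {θ | wNorm (fisher n θs) (θ - θs) ≤ s * √((d : ℝ) / n)}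

open Classical in
/-- `δ*₀₁(s) = sup {‖∇ log ρ(θ)‖_{F*} : θ ∈ U*(s)}`, with value `∞` if the prior `ρ` is not
`C¹` or not strictly positive on `U*(s)`. -/
def delta01 {d : ℕ} (n : ℕ) (ρ : EuclideanSpace ℝ (Fin d) → ℝ) (θs : EuclideanSpace ℝ (Fin d))
    (s : ℝ) : ℝ≥0∞ :=
  if ∀ θ ∈ nbhd n θs s, ContDiffAt ℝ 1 ρ θ ∧ 0 < ρ θ then
    ⨆ θ ∈ nbhd n θs s, dualNorm (fisher n θs) (fderiv ℝ (fun η => Real.log (ρ η)) θ)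
  else ⊤

/-- `M₀* = d⁻¹ log sup {ρ(θ) / ρ(θ*) : θ ∈ Θ}`, with value `∞` if `ρ` is unbounded on `Θ`. It is
used only when `ρ(θ*) > 0`. -/
def M0 {d : ℕ} (ρ : EuclideanSpace ℝ (Fin d) → ℝ) (θs : EuclideanSpace ℝ (Fin d)) : EReal :=
  (((d : ℝ)⁻¹ : ℝ) : EReal) * ENNReal.log (⨆ θ ∈ Theta d, ENNReal.ofReal (ρ θ / ρ θs))

/-- The measure on `Θ` with Lebesgue density `e^{-nℓ} ρ`. -/
def unnormPosterior {d : ℕ} (n : ℕ) (ρ : EuclideanSpace ℝ (Fin d) → ℝ) (N : Fin (d + 1) → ℕ) :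
    Measure (EuclideanSpace ℝ (Fin d)) :=
  (volume.restrict (Theta d)).withDensity
    (fun θ => ENNReal.ofReal (Real.exp (-(n * nll n N θ)) * ρ θ))

/-- The posterior `π ∝ e^{-nℓ} ρ` on `Θ`. It is a probability measure exactly if the
normalizing constant is neither `0` nor `∞`. -/
def posterior {d : ℕ} (n : ℕ) (ρ : EuclideanSpace ℝ (Fin d) → ℝ) (N : Fin (d + 1) → ℕ) :
    Measure (EuclideanSpace ℝ (Fin d)) :=
  (unnormPosterior n ρ N Set.univ)⁻¹ • unnormPosterior n ρ N

/-- `θh` is the unique minimizer of `ℓ` over `Θ`: the maximum likelihood estimator exists, is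
unique, and equals `θh`. -/
def IsUniqueMLE {d : ℕ} (n : ℕ) (N : Fin (d + 1) → ℕ) (θh : EuclideanSpace ℝ (Fin d)) : Prop :=
  θh ∈ Theta d ∧ ∀ θ ∈ Theta d, θ ≠ θh → nll n N θh < nll n N θ

/-- The Gaussian `γ* = 𝒩(θh, (n F*)⁻¹)`. -/
def gammaStar {d : ℕ} (n : ℕ) (θs θh : EuclideanSpace ℝ (Fin d)) :
    Measure (EuclideanSpace ℝ (Fin d)) :=
  multivariateGaussian θh ((n : ℝ) • fisher n θs)⁻¹

/-- The total variation distance `sup_A |μ(A) - ν(A)|` of two probability measures. -/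
def tvDist {E : Type*} [MeasurableSpace E] (μ ν : Measure E) : ℝ :=
  ⨆ A : {A : Set E // MeasurableSet A}, |μ.real A.1 - ν.real A.1|

end

end PmfBvM

/-! Since the prior enters only through a Lipschitz bound on its logarithm, a comparison is needed
that turns Lipschitz errors against a Gaussian into a total variation bound without losing powers of
the dimension. Prékopa–Leindler provides it. Let `g` be the density of `γ*`, `w` that of the
posterior, and `U` the Fisher ball of radius `s√(d/n)` around the truth. If `w x * g y ^ 2 ≤ e^η * w
y * g ((x+y)/2) ^ 2` on `U`, then the inequality applied to `w` and `g²/w` on `U`, with midpoint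
function `e^(η/2) g`, gives `(∫_U w)(∫_U g²/w) ≤ e^η`. When `U` carries almost all mass, this is a
bound on a chi-square divergence, and it controls total variation (`tvDist_le_of_midpoint`).

The midpoint condition comes from strong concavity. With `q` the squared Fisher norm, write the log
posterior density as `-n q(x - θh)/2` plus a remainder and an additive constant. If the remainder is
`E√n`-Lipschitz in the Fisher norm on `U`, the parallelogram identity produces a spare `-n q(x -
y)/4`, and `E z - z²/4 ≤ E²` with `z = √(n q(x - y))` absorbs the remainder: `η = E²`
(`log_posterior_oscillation`). The remainder has two parts. The log prior contributes `δ/√n` to `E`.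
The Taylor error of the log likelihood contributes `4 s² d/√(n θmin)`, because its directional
derivative is the sum of a product of three deviations, two handled by Cauchy–Schwarz and one by a
uniform relative bound (`sum_mul_log_add_quadratic_sub_le`). Both parts tend to zero under the
hypotheses.

Mass outside `U` is controlled by log-concavity alone. Contracting by one half towards the peak
costs a volume factor `2^d`, while the deficit of order `s² d` in the exponent wins for large `s`
(`setLIntegral_le_of_le_sq_midpoint`, `sum_mul_log_sub_le`). The prior changes this by at most a
factor `2 e^((C+1)d)`, which a larger `s` also beats.

All of this is deterministic once the empirical frequencies lie within Fisher distance `K√(d/n)` of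
the truth. Their squared distance has mean exactly `d/n`, so Markov's inequality makes this event as
likely as desired (`one_sub_le_multinomial`). On it the frequencies are strictly positive, hence
they are the unique maximum likelihood estimator. -/

namespace PmfBvM

/-! ### Brunn–Minkowski on the line and Prékopa–Leindler with equal weights -/

open scoped Pointwise in
/-- The one-dimensional Brunn–Minkowski inequality for compact sets. -/
lemma volume_add_le_two_mul_of_isCompact {K L C : Set ℝ} (hK : IsCompact K) (hL : IsCompact L)
    (hKn : K.Nonempty) (hLn : L.Nonempty) (hC : ∀ x ∈ K, ∀ y ∈ L, (x + y) / 2 ∈ C) :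
    volume K + volume L ≤ 2 * volume C := by
  -- With `u = max K` and `v = min L`, the half-size copies `(K + v)/2` and `(u + L)/2` lie in `C`
  -- and on opposite sides of `(u + v)/2`, so they overlap in a null set.
  obtain ⟨u, huK, hu⟩ := hK.exists_isGreatest hKn
  obtain ⟨v, hvL, hv⟩ := hL.exists_isLeast hLn
  have himg : ∀ (S : Set ℝ) (c : ℝ), volume ((fun x => 2⁻¹ * x + c) '' S) = 2⁻¹ * volume S := by
    intro S c
    have : (fun x : ℝ => 2⁻¹ * x + c) '' S = (fun x => c + x) '' ((2⁻¹ : ℝ) • S) := by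
      ext y
      simp only [Set.mem_image, Set.mem_smul_set, smul_eq_mul]
      constructor
      · rintro ⟨x, hx, rfl⟩; exact ⟨_, ⟨x, hx, rfl⟩, add_comm _ _⟩
      · rintro ⟨_, ⟨x, hx, rfl⟩, rfl⟩; exact ⟨x, hx, add_comm _ _⟩
    rw [this, Set.image_add_left, measure_preimage_add, Measure.addHaar_smul]
    congr 1
    simp [abs_of_pos]
  have h1 : (fun x => 2⁻¹ * x + v / 2) '' K ⊆ C := by
    rintro _ ⟨x, hx, rfl⟩
    convert hC x hx v hvL using 1; ring
  have h2 : (fun x => 2⁻¹ * x + u / 2) '' L ⊆ C := by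
    rintro _ ⟨x, hx, rfl⟩
    convert hC u huK x hx using 1; ring
  have hmeas : MeasurableSet ((fun x => 2⁻¹ * x + u / 2) '' L) :=
    (hL.image (by fun_prop)).isClosed.measurableSet
  have hdisj : AEDisjoint volume ((fun x => 2⁻¹ * x + v / 2) '' K)
      ((fun x => 2⁻¹ * x + u / 2) '' L) := by
    refine measure_mono_null ?_ (Real.volume_singleton (a := (u + v) / 2))
    rintro _ ⟨⟨x, hx, rfl⟩, ⟨y, hy, hxy⟩⟩
    have := hu hx
    have := hv hy
    simp only at hxy
    simp only [Set.mem_singleton_iff]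
    linarith
  have h3 := measure_mono (μ := volume) (Set.union_subset h1 h2)
  rw [measure_union₀ hmeas.nullMeasurableSet hdisj, himg, himg, ← mul_add] at h3
  calc volume K + volume L = 2 * (2⁻¹ * (volume K + volume L)) := by
        rw [← mul_assoc, ENNReal.mul_inv_cancel (by simp) (by simp), one_mul]
    _ ≤ _ := by gcongr

/-- The one-dimensional Brunn–Minkowski inequality. -/
lemma volume_add_le_two_mul {A B C : Set ℝ} (hA : MeasurableSet A) (hB : MeasurableSet B)
    (hAn : A.Nonempty) (hBn : B.Nonempty) (hC : ∀ x ∈ A, ∀ y ∈ B, (x + y) / 2 ∈ C) :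
    volume A + volume B ≤ 2 * volume C := by
  obtain ⟨a, ha⟩ := hAn
  obtain ⟨b, hb⟩ := hBn
  rw [hA.measure_eq_iSup_isCompact, hB.measure_eq_iSup_isCompact]
  simp only [iSup_and']
  refine ENNReal.biSup_add_biSup_le' ⟨∅, by simp, isCompact_empty⟩ ⟨∅, by simp, isCompact_empty⟩ ?_
  rintro K ⟨hKA, hK⟩ L ⟨hLB, hL⟩
  -- An approximating compact set may be empty; inserting a point of `A` or `B` restores
  -- nonemptiness.
  refine le_trans (add_le_add (measure_mono (Set.subset_insert a K))
    (measure_mono (Set.subset_insert b L))) ?_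
  refine volume_add_le_two_mul_of_isCompact (hK.insert a) (hL.insert b) ⟨a, by simp⟩ ⟨b, by simp⟩ ?_
  intro x hx y hy
  exact hC x (Set.insert_subset ha hKA hx) y (Set.insert_subset hb hLB hy)

/-- The one-dimensional Prékopa–Leindler inequality for functions with supremum one. -/
lemma lintegral_add_le_two_mul_of_sup_eq_one {a b f : ℝ → ℝ} (ha : Measurable a)
    (hb : Measurable b) (hf : Measurable f) (ha0 : ∀ x, 0 ≤ a x) (hb0 : ∀ x, 0 ≤ b x)
    (hf0 : ∀ x, 0 ≤ f x) (ha1 : ∀ x, a x ≤ 1) (hb1 : ∀ x, b x ≤ 1)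
    (has : ∀ t < 1, ∃ x, t < a x) (hbs : ∀ t < 1, ∃ x, t < b x)
    (h : ∀ x y, a x * b y ≤ f ((x + y) / 2) ^ 2) :
    (∫⁻ x, ENNReal.ofReal (a x)) + ∫⁻ x, ENNReal.ofReal (b x)
      ≤ 2 * ∫⁻ x, ENNReal.ofReal (f x) := by
  rw [lintegral_eq_lintegral_meas_lt volume (.of_forall ha0) ha.aemeasurable,
    lintegral_eq_lintegral_meas_lt volume (.of_forall hb0) hb.aemeasurable,
    lintegral_eq_lintegral_meas_lt volume (.of_forall hf0) hf.aemeasurable,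
    ← lintegral_const_mul' _ _ (by simp), ← lintegral_add_left]
  · refine setLIntegral_mono' measurableSet_Ioi fun t ht => ?_
    -- Layer cake: below height one both superlevel sets are nonempty, so Brunn–Minkowski compares
    -- them; from height one on they are empty. The common supremum is what makes these ranges
    -- agree.
    rcases lt_or_ge t 1 with h1 | h1
    · refine volume_add_le_two_mul (ha measurableSet_Ioi) (hb measurableSet_Ioi) (has t h1)
        (hbs t h1) fun x hx y hy => ?_
      simp only [Set.mem_ofPred_eq, Set.mem_Ioi] at hx hy ht ⊢
      have := h x y
      by_contra! hcon
      have := hf0 ((x + y) / 2)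
      nlinarith
    · have e1 : {x | t < a x} = ∅ := by ext x; simpa using (ha1 x).trans h1
      have e2 : {x | t < b x} = ∅ := by ext x; simpa using (hb1 x).trans h1
      simp [e1, e2]
  · exact Antitone.measurable fun s t hst => measure_mono fun x hx => lt_of_le_of_lt hst hx

lemma iSup_div_toReal_spec {a : ℝ → ℝ≥0∞} (h0 : ⨆ x, a x ≠ 0) (ht : ⨆ x, a x ≠ ⊤) :
    (∀ x, (a x / ⨆ x, a x).toReal ≤ 1) ∧ ∀ t < 1, ∃ x, t < (a x / ⨆ x, a x).toReal := by
  have hle : ∀ x, a x / (⨆ x, a x) ≤ 1 := fun x =>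
    ENNReal.div_le_of_le_mul (by simpa using le_iSup a x)
  refine ⟨fun x => by simpa using ENNReal.toReal_mono ENNReal.one_ne_top (hle x), fun t ht1 => ?_⟩
  have hlt : ENNReal.ofReal (max t 0) * (⨆ x, a x) < ⨆ x, a x := by
    conv_rhs => rw [← one_mul (⨆ x, a x)]
    exact ENNReal.mul_lt_mul_left h0 ht (by simpa using ht1)
  obtain ⟨x, hx⟩ := lt_iSup_iff.1 hlt
  refine ⟨x, (le_max_left t 0).trans_lt ?_⟩
  have := (ENNReal.lt_div_iff_mul_lt (.inl h0) (.inl ht)).2 hx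
  exact (ENNReal.ofReal_lt_iff_lt_toReal (le_max_right _ _)
    (ne_top_of_le_ne_top ENNReal.one_ne_top (hle x))).1 this

/-- The one-dimensional Prékopa–Leindler inequality for bounded functions. -/
lemma lintegral_mul_lintegral_le_sq_of_bounded {a b f : ℝ → ℝ≥0∞} (ha : Measurable a)
    (hb : Measurable b) (hf : Measurable f) (hat : ⨆ x, a x ≠ ⊤) (hbt : ⨆ x, b x ≠ ⊤)
    (h : ∀ x y, a x * b y ≤ f ((x + y) / 2) ^ 2) :
    (∫⁻ x, a x) * ∫⁻ x, b x ≤ (∫⁻ x, f x) ^ 2 := by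
  by_cases ha0 : ⨆ x, a x = 0
  · simp_all
  by_cases hb0 : ⨆ x, b x = 0
  · simp_all
  by_cases hft : ∫⁻ x, f x = ⊤
  · simp [hft]
  obtain ⟨ha1, has⟩ := iSup_div_toReal_spec ha0 hat
  obtain ⟨hb1, hbs⟩ := iSup_div_toReal_spec hb0 hbt
  set α := ⨆ x, a x with hα
  set β := ⨆ x, b x with hβ
  have hα' : 0 < α.toReal := ENNReal.toReal_pos ha0 hat
  have hβ' : 0 < β.toReal := ENNReal.toReal_pos hb0 hbt
  set r := ENNReal.ofReal (√(α.toReal * β.toReal)) with hr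
  have hr2 : r ^ 2 = α * β := by
    rw [hr, ← ENNReal.ofReal_pow (by positivity), Real.sq_sqrt (by positivity),
      ENNReal.ofReal_mul hα'.le, ENNReal.ofReal_toReal hat, ENNReal.ofReal_toReal hbt]
  have hr0 : r ≠ 0 := by
    rw [hr]; simp only [ne_eq, ENNReal.ofReal_eq_zero, not_le]; positivity
  have hrt : r ≠ ⊤ := ENNReal.ofReal_ne_top
  have hat' : ∀ x, a x / α ≠ ⊤ := fun x =>
    (ENNReal.div_lt_top (ne_top_of_le_ne_top hat (le_iSup a x)) ha0).ne
  have hbt' : ∀ x, b x / β ≠ ⊤ := fun x =>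
    (ENNReal.div_lt_top (ne_top_of_le_ne_top hbt (le_iSup b x)) hb0).ne
  -- Both functions are scaled to supremum one, so `f` is scaled by `r = √(αβ)`. Truncating `f / r`
  -- at one keeps it finite and loses nothing, since the scaled product is at most one.
  have key := lintegral_add_le_two_mul_of_sup_eq_one (a := fun x => (a x / α).toReal)
    (b := fun x => (b x / β).toReal) (f := fun x => (min (f x / r) 1).toReal)
    (by fun_prop) (by fun_prop) (by fun_prop) (fun x => by positivity) (fun x => by positivity)
    (fun x => by positivity) ha1 hb1 has hbs (fun x y => by
      have h1 : a x / α * (b y / β) ≤ (f ((x + y) / 2) / r) ^ 2 := by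
        rw [ENNReal.div_eq_inv_mul, ENNReal.div_eq_inv_mul, ENNReal.div_eq_inv_mul, mul_pow,
          ← ENNReal.inv_pow, hr2, ENNReal.mul_inv (.inl ha0) (.inl hat)]
        calc α⁻¹ * a x * (β⁻¹ * b y) = α⁻¹ * β⁻¹ * (a x * b y) := by ring
          _ ≤ _ := by gcongr; exact h x y
      have h2 : a x / α * (b y / β) ≤ 1 := by
        rw [← one_mul (1 : ℝ≥0∞)]
        gcongr
        · exact ENNReal.div_le_of_le_mul (by simpa using le_iSup a x)
        · exact ENNReal.div_le_of_le_mul (by simpa using le_iSup b y)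
      rw [← ENNReal.toReal_mul, ← ENNReal.toReal_pow]
      refine ENNReal.toReal_mono (by simp) ?_
      rcases le_total (f ((x + y) / 2) / r) 1 with h3 | h3
      · rwa [min_eq_left h3]
      · rwa [min_eq_right h3, one_pow])
  have e1 : ∫⁻ x, ENNReal.ofReal (a x / α).toReal = (∫⁻ x, a x) / α := by
    simp_rw [ENNReal.ofReal_toReal (hat' _), div_eq_mul_inv]
    rw [lintegral_mul_const _ ha]
  have e2 : ∫⁻ x, ENNReal.ofReal (b x / β).toReal = (∫⁻ x, b x) / β := by
    simp_rw [ENNReal.ofReal_toReal (hbt' _), div_eq_mul_inv]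
    rw [lintegral_mul_const _ hb]
  have e3 : ∫⁻ x, ENNReal.ofReal (min (f x / r) 1).toReal ≤ (∫⁻ x, f x) / r := by
    simp_rw [div_eq_mul_inv]
    rw [← lintegral_mul_const _ hf]
    refine lintegral_mono fun x => ?_
    exact ENNReal.ofReal_toReal_le.trans (min_le_left _ _)
  rw [e1, e2] at key
  have key2 := key.trans (mul_le_mul_right e3 2)
  have hFt : 2 * ((∫⁻ x, f x) / r) ≠ ⊤ :=
    ENNReal.mul_ne_top (by simp) (ENNReal.div_lt_top hft hr0).ne
  have hAt : (∫⁻ x, a x) / α ≠ ⊤ := ne_top_of_le_ne_top hFt (le_self_add.trans key2)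
  have hBt : (∫⁻ x, b x) / β ≠ ⊤ := ne_top_of_le_ne_top hFt (le_add_self.trans key2)
  have key3 := ENNReal.toReal_mono hFt key2
  rw [ENNReal.toReal_add hAt hBt, ENNReal.toReal_mul] at key3
  -- The additive bound becomes multiplicative by the inequality of arithmetic and geometric means.
  have key4 : (∫⁻ x, a x) / α * ((∫⁻ x, b x) / β) ≤ ((∫⁻ x, f x) / r) ^ 2 := by
    rw [← ENNReal.toReal_le_toReal (ENNReal.mul_ne_top hAt hBt)
      (ENNReal.pow_ne_top (ENNReal.div_lt_top hft hr0).ne), ENNReal.toReal_mul, ENNReal.toReal_pow]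
    have := sq_nonneg (((∫⁻ x, a x) / α).toReal - ((∫⁻ x, b x) / β).toReal)
    have p1 : 0 ≤ ((∫⁻ x, a x) / α).toReal := by positivity
    have p2 : 0 ≤ ((∫⁻ x, b x) / β).toReal := by positivity
    simp only [ENNReal.toReal_ofNat] at key3
    nlinarith
  calc (∫⁻ x, a x) * ∫⁻ x, b x
      = (α * β) * ((∫⁻ x, a x) / α * ((∫⁻ x, b x) / β)) := by
        rw [show (α * β) * ((∫⁻ x, a x) / α * ((∫⁻ x, b x) / β))
          = (α * ((∫⁻ x, a x) / α)) * (β * ((∫⁻ x, b x) / β)) by ring,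
          ENNReal.mul_div_cancel ha0 hat, ENNReal.mul_div_cancel hb0 hbt]
    _ ≤ (α * β) * ((∫⁻ x, f x) / r) ^ 2 := by gcongr
    _ = (∫⁻ x, f x) ^ 2 := by
        rw [← hr2, ← mul_pow, ENNReal.mul_div_cancel hr0 hrt]

/-- The one-dimensional Prékopa–Leindler inequality. -/
lemma lintegral_mul_lintegral_le_sq {a b f : ℝ → ℝ≥0∞} (ha : Measurable a)
    (hb : Measurable b) (hf : Measurable f) (h : ∀ x y, a x * b y ≤ f ((x + y) / 2) ^ 2) :
    (∫⁻ x, a x) * ∫⁻ x, b x ≤ (∫⁻ x, f x) ^ 2 := by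
  have htrunc : ∀ {u : ℝ → ℝ≥0∞}, Measurable u →
      ∫⁻ x, u x = ⨆ n : ℕ, ∫⁻ x, min (u x) n := by
    intro u hu
    rw [← lintegral_iSup (fun n => by fun_prop) (fun m n hmn x => by dsimp only; gcongr)]
    refine lintegral_congr fun x => ?_
    rw [← inf_iSup_eq, ENNReal.iSup_natCast, inf_top_eq]
  have hsup : ∀ (u : ℝ → ℝ≥0∞) (n : ℕ), ⨆ x, min (u x) (n : ℝ≥0∞) ≠ ⊤ := fun u n =>
    ne_top_of_le_ne_top (ENNReal.natCast_ne_top n) (iSup_le fun x => min_le_right _ _)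
  rw [htrunc ha, htrunc hb]
  simp_rw [ENNReal.iSup_mul, ENNReal.mul_iSup]
  refine iSup_le fun m => iSup_le fun n => ?_
  refine lintegral_mul_lintegral_le_sq_of_bounded (by fun_prop) (by fun_prop) hf (hsup _ _)
    (hsup _ _) fun x y => (mul_le_mul' (min_le_left _ _) (min_le_left _ _)).trans (h x y)

/-- The Prékopa–Leindler inequality, with equal weights, on `ℝⁿ`. -/
lemma lintegral_pi_mul_lintegral_pi_le_sq {n : ℕ} {a b f : (Fin n → ℝ) → ℝ≥0∞} (ha : Measurable a)
    (hb : Measurable b) (hf : Measurable f)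
    (h : ∀ x y, a x * b y ≤ f (fun i => (x i + y i) / 2) ^ 2) :
    (∫⁻ x, a x) * ∫⁻ x, b x ≤ (∫⁻ x, f x) ^ 2 := by
  induction n with
  | zero =>
    have hs : ∀ u : (Fin 0 → ℝ) → ℝ≥0∞, ∫⁻ x, u x = u default := fun u => by
      rw [volume_pi, Measure.pi_of_empty _ default, lintegral_dirac]
    rw [hs, hs, hs]
    convert h default default
  | succ n ih =>
    have hcons : ∀ p : ℝ × (Fin n → ℝ),
        (MeasurableEquiv.piFinSuccAbove (fun _ : Fin (n + 1) => ℝ) 0).symm p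
          = (Fin.cons p.1 p.2 : Fin (n + 1) → ℝ) := fun p => by
      simp [MeasurableEquiv.piFinSuccAbove, Fin.insertNthEquiv]
    have hs : ∀ {u : (Fin (n + 1) → ℝ) → ℝ≥0∞}, Measurable u →
        ∫⁻ x, u x = ∫⁻ s : ℝ, ∫⁻ z : Fin n → ℝ, u (Fin.cons s z) := by
      intro u hu
      have hm := (volume_preserving_piFinSuccAbove (fun _ : Fin (n + 1) => ℝ) 0).symm
      rw [← hm.lintegral_comp hu, Measure.volume_eq_prod, lintegral_prod]
      · simp_rw [hcons]
      · exact (hu.comp hm.measurable).aemeasurable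
    have hmeas : ∀ {u : (Fin (n + 1) → ℝ) → ℝ≥0∞}, Measurable u →
        Measurable fun p : ℝ × (Fin n → ℝ) => u (Fin.cons p.1 p.2) := by
      intro u hu
      simp_rw [← hcons]
      exact hu.comp (MeasurableEquiv.measurable _)
    rw [hs ha, hs hb, hs hf]
    -- The fibre integrals satisfy the one-dimensional hypothesis in the first coordinate, by the
    -- induction hypothesis applied on the fibres over `s`, `t` and their midpoint.
    refine lintegral_mul_lintegral_le_sq (hmeas ha).lintegral_prod_right'
      (hmeas hb).lintegral_prod_right' (hmeas hf).lintegral_prod_right' fun s t => ?_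
    refine ih ((hmeas ha).comp measurable_prodMk_left) ((hmeas hb).comp measurable_prodMk_left)
      ((hmeas hf).comp measurable_prodMk_left) fun x y => ?_
    refine (h _ _).trans (le_of_eq ?_)
    congr 2
    ext i
    refine Fin.cases ?_ (fun j => ?_) i <;> simp

/-- The Prékopa–Leindler inequality, with equal weights, on a Euclidean space. -/
lemma lintegral_euclidean_mul_le_sq {n : ℕ} {a b f : EuclideanSpace ℝ (Fin n) → ℝ≥0∞}
    (ha : Measurable a) (hb : Measurable b) (hf : Measurable f)
    (h : ∀ x y, a x * b y ≤ f ((1 / 2 : ℝ) • (x + y)) ^ 2) :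
    (∫⁻ x, a x) * ∫⁻ x, b x ≤ (∫⁻ x, f x) ^ 2 := by
  have hm := PiLp.volume_preserving_toLp (Fin n)
  rw [← hm.lintegral_comp ha, ← hm.lintegral_comp hb, ← hm.lintegral_comp hf]
  refine lintegral_pi_mul_lintegral_pi_le_sq (ha.comp hm.measurable) (hb.comp hm.measurable)
    (hf.comp hm.measurable) fun x y => (h _ _).trans (le_of_eq ?_)
  congr 2
  ext i
  simp
  ring

/-! ### Gaussian densities -/

lemma pi_gaussianReal_eq_withDensity (d : ℕ) :
    Measure.pi (fun _ : Fin d => gaussianReal 0 1) = volume.withDensity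
      (fun x => ENNReal.ofReal (∏ i, gaussianPDFReal 0 1 (x i))) := by
  refine Measure.pi_eq fun s hs => ?_
  have hint : ∀ i, IntegrableOn (gaussianPDFReal 0 1) (s i) := fun i =>
    (integrable_gaussianPDFReal 0 1).integrableOn
  rw [withDensity_apply _ (MeasurableSet.univ_pi hs), volume_pi, Measure.restrict_pi_pi,
    ← ofReal_integral_eq_lintegral_ofReal (Integrable.fintype_prod hint)
      (.of_forall fun x => Finset.prod_nonneg fun i _ => gaussianPDFReal_nonneg _ _ _),
    integral_fintype_prod_eq_prod, ENNReal.ofReal_prod_of_nonneg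
      fun i _ => integral_nonneg fun x => gaussianPDFReal_nonneg _ _ _]
  refine Finset.prod_congr rfl fun i _ => ?_
  rw [gaussianReal_of_var_ne_zero _ one_ne_zero, withDensity_apply _ (hs i),
    ofReal_integral_eq_lintegral_ofReal (hint i)
      (.of_forall fun x => gaussianPDFReal_nonneg _ _ _)]
  rfl

lemma map_withDensity_comp {α β : Type*} [MeasurableSpace α] [MeasurableSpace β] {μ : Measure α}
    {T : α → β} (hT : Measurable T) {f : β → ℝ≥0∞} (hf : Measurable f) :
    (μ.withDensity (f ∘ T)).map T = (μ.map T).withDensity f := by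
  ext s hs
  rw [Measure.map_apply hT hs, withDensity_apply _ (hT hs), withDensity_apply _ hs,
    setLIntegral_map hs hf hT]
  rfl

lemma stdGaussian_eq_withDensity (d : ℕ) : ∃ k : ℝ, 0 < k ∧
    stdGaussian (EuclideanSpace ℝ (Fin d)) = volume.withDensity
      (fun x => ENNReal.ofReal (k * Real.exp (-(x.ofLp ⬝ᵥ x.ofLp) / 2))) := by
  refine ⟨(√(2 * Real.pi))⁻¹ ^ d, by positivity, ?_⟩
  have hm := PiLp.volume_preserving_toLp (Fin d)
  rw [← map_pi_eq_stdGaussian, pi_gaussianReal_eq_withDensity]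
  conv_rhs => rw [← hm.map_eq, ← map_withDensity_comp hm.measurable (by fun_prop)]
  congr 2
  funext x
  simp only [Function.comp, gaussianPDFReal, Finset.prod_mul_distrib, Finset.prod_const,
    Finset.card_univ, Fintype.card_fin, ← Real.exp_sum]
  congr 3
  · simp
  · simp [dotProduct, ← Finset.sum_div, pow_two]

/-- The density of a nondegenerate Gaussian given by its precision matrix. -/
lemma multivariateGaussian_inv_eq_withDensity {d : ℕ} {A : Matrix (Fin d) (Fin d) ℝ}
    (hA : A.PosDef) (m : EuclideanSpace ℝ (Fin d)) : ∃ k : ℝ, 0 < k ∧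
    multivariateGaussian m A⁻¹ = volume.withDensity (fun x =>
      ENNReal.ofReal (k * Real.exp (-((x - m).ofLp ⬝ᵥ (A *ᵥ (x - m).ofLp)) / 2))) := by
  open scoped MatrixOrder in
  obtain ⟨k, hk, hstd⟩ := stdGaussian_eq_withDensity d
  set R := CFC.sqrt A⁻¹ with hR
  have hRR : R * R = A⁻¹ := CFC.sqrt_mul_sqrt_self _ hA.inv.posSemidef.nonneg
  have hdet : IsUnit A.det := (Matrix.isUnit_iff_isUnit_det A).1 hA.isUnit
  have h1 : R * (R * A) = 1 := by rw [← mul_assoc, hRR, Matrix.nonsing_inv_mul _ hdet]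
  -- The Gaussian is the image of the standard one under `x ↦ m + R x` with `R = √(A⁻¹)`; this
  -- identity turns `|x|²` into the form of `A` at `R x`. The normalizing constant is left
  -- unidentified because the later comparison is homogeneous in it.
  have h2 : R * A * R = 1 := mul_eq_one_comm.1 h1
  have hsymm : Rᵀ = R := by
    have := (CFC.sqrt_nonneg A⁻¹).isSelfAdjoint
    simpa [IsSelfAdjoint, Matrix.star_eq_conjTranspose] using this
  set B := Matrix.toEuclideanCLM (𝕜 := ℝ) R with hB
  have hBof : ∀ x, (B x).ofLp = R *ᵥ x.ofLp := fun x => by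
    rw [hB]; exact Matrix.ofLp_toEuclideanCLM R x
  have hdetB : LinearMap.det (B : EuclideanSpace ℝ (Fin d) →ₗ[ℝ] EuclideanSpace ℝ (Fin d)) ≠ 0 := by
    have hc : (B : EuclideanSpace ℝ (Fin d) →ₗ[ℝ] EuclideanSpace ℝ (Fin d)) *
        (Matrix.toEuclideanCLM (𝕜 := ℝ) (R * A) : EuclideanSpace ℝ (Fin d) →L[ℝ] _) = 1 := by
      refine LinearMap.ext fun x => ?_
      have : (B * Matrix.toEuclideanCLM (𝕜 := ℝ) (R * A)) x = x := by
        rw [hB, ← map_mul, h1, map_one]; rfl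
      exact this
    intro h0
    have h3 := congrArg LinearMap.det hc
    rw [map_mul, h0, zero_mul, map_one] at h3
    exact zero_ne_one h3
  have hmap : (volume : Measure (EuclideanSpace ℝ (Fin d))).map (fun x => m + B x)
      = ENNReal.ofReal |(LinearMap.det
        (B : EuclideanSpace ℝ (Fin d) →ₗ[ℝ] EuclideanSpace ℝ (Fin d)))⁻¹| • volume := by
    have := Measure.map_linearMap_addHaar_eq_smul_addHaar
      (volume : Measure (EuclideanSpace ℝ (Fin d))) hdetB
    rw [show (fun x => m + B x) = (fun x => m + x) ∘ B from rfl,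
      ← Measure.map_map (by fun_prop) (by fun_prop)]
    erw [this]
    rw [Measure.map_smul, map_add_left_eq_self]
  have hquad : ∀ x, x.ofLp ⬝ᵥ x.ofLp
      = (m + B x - m).ofLp ⬝ᵥ (A *ᵥ (m + B x - m).ofLp) := fun x => by
    rw [add_sub_cancel_left, hBof, Matrix.mulVec_mulVec]
    conv_rhs => rw [← hsymm, Matrix.mulVec_transpose, hsymm]
    rw [← Matrix.dotProduct_mulVec, Matrix.mulVec_mulVec, ← mul_assoc, h2, Matrix.one_mulVec]
  have hsmul : ∀ c : ℝ, 0 ≤ c → ∀ f : EuclideanSpace ℝ (Fin d) → ℝ, Measurable f →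
      (ENNReal.ofReal c • (volume : Measure (EuclideanSpace ℝ (Fin d)))).withDensity
        (fun x => ENNReal.ofReal (f x)) = volume.withDensity (fun x => ENNReal.ofReal (c * f x)) := by
    intro c hc f hf
    rw [withDensity_smul_measure, ← withDensity_smul _ (by fun_prop)]
    congr 1
    funext x
    simp [ENNReal.ofReal_mul hc]
  have hfm : Measurable fun x : EuclideanSpace ℝ (Fin d) =>
      k * Real.exp (-((x - m).ofLp ⬝ᵥ (A *ᵥ (x - m).ofLp)) / 2) := by
    simp only [dotProduct, Matrix.mulVec]; fun_prop
  refine ⟨|(LinearMap.det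
        (B : EuclideanSpace ℝ (Fin d) →ₗ[ℝ] EuclideanSpace ℝ (Fin d)))⁻¹| * k, by positivity, ?_⟩
  rw [multivariateGaussian, hstd, ← hR, ← hB]
  simp_rw [hquad]
  rw [show (fun x => ENNReal.ofReal (k * Real.exp (-((m + B x - m).ofLp ⬝ᵥ
    (A *ᵥ (m + B x - m).ofLp)) / 2))) = (fun x => ENNReal.ofReal (k * Real.exp (-((x - m).ofLp ⬝ᵥ
    (A *ᵥ (x - m).ofLp)) / 2))) ∘ (fun x => m + B x) from rfl,
    map_withDensity_comp (by fun_prop) (by fun_prop), hmap, hsmul _ (by positivity) _ hfm]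
  simp_rw [mul_assoc]

/-! ### Tail and total variation bounds for densities -/

/-- Tail bound for a density `f` with peak height `m` at `c`, whose log-deficit `log (m / f)` at
least halves when the distance to `c` is halved. -/
lemma setLIntegral_le_of_le_sq_midpoint {d : ℕ} {f : EuclideanSpace ℝ (Fin d) → ℝ}
    (hf : Measurable f) (hf0 : ∀ x, 0 ≤ f x) (c : EuclideanSpace ℝ (Fin d)) {m a : ℝ}
    (hmid : ∀ x, f x * m ≤ f (c + (1 / 2 : ℝ) • (x - c)) ^ 2) {W : Set (EuclideanSpace ℝ (Fin d))}
    (hW : MeasurableSet W) (hWle : ∀ x ∈ W, f x ≤ Real.exp (-a) * m) :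
    ∫⁻ x in W, ENNReal.ofReal (f x)
      ≤ ENNReal.ofReal (Real.exp (-a / 2) * 2 ^ d) * ∫⁻ x, ENNReal.ofReal (f x) := by
  -- On `W`, `f(x)² ≤ e^(-a) m f(x) ≤ e^(-a) f(mid)²`, where `mid` is the midpoint of `x` and `c`.
  -- Integrating `f(mid)` over the whole space then costs the Jacobian `2^d`.
  have hpt : ∀ x ∈ W, ENNReal.ofReal (f x) ≤ ENNReal.ofReal (Real.exp (-a / 2)) *
      ENNReal.ofReal (f (c + (1 / 2 : ℝ) • (x - c))) := by
    intro x hx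
    rw [← ENNReal.ofReal_mul (Real.exp_pos _).le]
    refine ENNReal.ofReal_le_ofReal ?_
    have he : Real.exp (-a) = Real.exp (-a / 2) ^ 2 := by
      rw [← Real.exp_nat_mul]; congr 1; push_cast; ring
    have h1 := hWle x hx
    have h2 := hmid x
    have h3 := hf0 x
    refine abs_le_of_sq_le_sq' ?_ (by have := hf0 (c + (1 / 2 : ℝ) • (x - c)); positivity) |>.2
    have h4 : f x * f x ≤ (Real.exp (-a) * m) * f x := by gcongr
    calc f x ^ 2 ≤ Real.exp (-a) * (f x * m) := by linarith
      _ ≤ Real.exp (-a) * f (c + (1 / 2 : ℝ) • (x - c)) ^ 2 := by gcongr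
      _ = _ := by rw [he]; ring
  have hscale : ∫⁻ x, ENNReal.ofReal (f (c + (1 / 2 : ℝ) • (x - c)))
      = ENNReal.ofReal (2 ^ d) * ∫⁻ x, ENNReal.ofReal (f x) := by
    have hF : Measurable fun x => ENNReal.ofReal (f (c + x)) := by fun_prop
    rw [lintegral_sub_right_eq_self (fun x => ENNReal.ofReal (f (c + (1 / 2 : ℝ) • x))) c,
      ← lintegral_map (f := fun x => ENNReal.ofReal (f (c + x))) hF
        (measurable_const_smul (1 / 2 : ℝ)), Measure.map_addHaar_smul _ (by norm_num),
      lintegral_smul_measure, lintegral_add_left_eq_self (fun x => ENNReal.ofReal (f x)) c]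
    simp [abs_of_pos]
  calc ∫⁻ x in W, ENNReal.ofReal (f x)
      ≤ ∫⁻ x in W, ENNReal.ofReal (Real.exp (-a / 2)) *
        ENNReal.ofReal (f (c + (1 / 2 : ℝ) • (x - c))) := setLIntegral_mono' hW hpt
    _ ≤ ∫⁻ x, ENNReal.ofReal (Real.exp (-a / 2)) *
        ENNReal.ofReal (f (c + (1 / 2 : ℝ) • (x - c))) := setLIntegral_le_lintegral _ _
    _ = _ := by
      rw [lintegral_const_mul' _ _ ENNReal.ofReal_ne_top, hscale, ← mul_assoc,
        ← ENNReal.ofReal_mul (Real.exp_pos _).le]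

lemma measureReal_withDensity_ofReal {α : Type*} [MeasurableSpace α] {μ : Measure α} {w : α → ℝ}
    (hw : Integrable w μ) (hw0 : ∀ x, 0 ≤ w x) {S : Set α} (hS : MeasurableSet S) :
    (μ.withDensity fun x => ENNReal.ofReal (w x)).real S = ∫ x in S, w x ∂μ := by
  rw [measureReal_def, withDensity_apply _ hS,
    ← ofReal_integral_eq_lintegral_ofReal hw.integrableOn (.of_forall hw0),
    ENNReal.toReal_ofReal (integral_nonneg hw0)]

lemma integrable_of_withDensity_isProbabilityMeasure {α : Type*} [MeasurableSpace α]
    {μ π : Measure α} [IsProbabilityMeasure π] {w : α → ℝ} (hw : Measurable w)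
    (hw0 : ∀ x, 0 ≤ w x) (hπ : π = μ.withDensity fun x => ENNReal.ofReal (w x)) :
    Integrable w μ := by
  refine ⟨hw.aestronglyMeasurable, ?_⟩
  rw [hasFiniteIntegral_iff_ofReal (.of_forall hw0)]
  have := measure_univ (μ := π)
  rw [hπ, withDensity_apply _ .univ, setLIntegral_univ] at this
  simp [this]

lemma one_sub_le_measureReal {α : Type*} [MeasurableSpace α] {π : Measure α}
    [IsProbabilityMeasure π] {U : Set α} (hU : MeasurableSet U) {κ : ℝ} (hκ0 : 0 ≤ κ)
    (h : π Uᶜ ≤ ENNReal.ofReal κ) : π.real Uᶜ ≤ κ ∧ 1 - κ ≤ π.real U := by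
  have h1 : π.real Uᶜ ≤ κ := ENNReal.toReal_le_of_le_ofReal hκ0 h
  refine ⟨h1, ?_⟩
  rw [probReal_compl_eq_one_sub hU] at h1
  linarith

/-- Total variation bound for two densities whose ratio has small oscillation on `U`, relative to
the log-concavity of `g`. -/
lemma tvDist_le_of_midpoint {d : ℕ} {g w : EuclideanSpace ℝ (Fin d) → ℝ}
    (hg : Measurable g) (hw : Measurable w) (hg0 : ∀ x, 0 < g x) (hw0 : ∀ x, 0 ≤ w x)
    {U : Set (EuclideanSpace ℝ (Fin d))} (hU : MeasurableSet U) (hwU : ∀ x ∈ U, 0 < w x)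
    {γ π : Measure (EuclideanSpace ℝ (Fin d))} [IsProbabilityMeasure γ] [IsProbabilityMeasure π]
    (hγ : γ = volume.withDensity fun x => ENNReal.ofReal (g x))
    (hπ : π = volume.withDensity fun x => ENNReal.ofReal (w x)) {η κ t : ℝ}
    (hratio : ∀ x ∈ U, ∀ y ∈ U,
      w x * g y ^ 2 ≤ Real.exp η * w y * g ((1 / 2 : ℝ) • (x + y)) ^ 2)
    (hκ0 : 0 ≤ κ) (hκ1 : κ < 1) (hπU : π Uᶜ ≤ ENNReal.ofReal κ) (hγU : γ Uᶜ ≤ ENNReal.ofReal κ)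
    (ht : 0 < t) :
    tvDist π γ ≤ (t + (Real.exp η / (1 - κ) - 1 + 2 * κ) / t) / 2 + κ := by
  have hgi := integrable_of_withDensity_isProbabilityMeasure hg (fun x => (hg0 x).le) hγ
  have hwi := integrable_of_withDensity_isProbabilityMeasure hw hw0 hπ
  have hgS : ∀ {S}, MeasurableSet S → γ.real S = ∫ x in S, g x := fun hS => by
    rw [hγ, measureReal_withDensity_ofReal hgi (fun x => (hg0 x).le) hS]
  have hwS : ∀ {S}, MeasurableSet S → π.real S = ∫ x in S, w x := fun hS => by
    rw [hπ, measureReal_withDensity_ofReal hwi hw0 hS]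
  obtain ⟨hπU', hπU1⟩ := one_sub_le_measureReal hU hκ0 hπU
  obtain ⟨hγU', hγU1⟩ := one_sub_le_measureReal hU hκ0 hγU
  -- The central use of Prékopa–Leindler: `w` and `g²/w` on `U` against `e^(η/2) g`, whose integral
  -- is `e^(η/2)`. Dividing by `∫_U w ≥ 1 - κ` leaves the second integral.
  have hI : ∫⁻ x in U, ENNReal.ofReal (g x ^ 2 / w x) ≤ ENNReal.ofReal (Real.exp η / (1 - κ)) := by
    have hPL := lintegral_euclidean_mul_le_sq
      (a := U.indicator fun x => ENNReal.ofReal (w x))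
      (b := U.indicator fun x => ENNReal.ofReal (g x ^ 2 / w x))
      (f := fun x => ENNReal.ofReal (Real.exp (η / 2)) * ENNReal.ofReal (g x))
      ((by fun_prop : Measurable fun x => ENNReal.ofReal (w x)).indicator hU)
      ((by fun_prop : Measurable fun x => ENNReal.ofReal (g x ^ 2 / w x)).indicator hU)
      (by fun_prop) (fun x y => by
        by_cases hx : x ∈ U
        · by_cases hy : y ∈ U
          · rw [Set.indicator_of_mem hx, Set.indicator_of_mem hy, ← ENNReal.ofReal_mul (hw0 x),
              ← ENNReal.ofReal_mul (Real.exp_pos _).le,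
              ← ENNReal.ofReal_pow (mul_nonneg (Real.exp_pos _).le (hg0 _).le)]
            refine ENNReal.ofReal_le_ofReal ?_
            rw [mul_pow, ← Real.exp_nat_mul, ← mul_div_assoc, div_le_iff₀ (hwU y hy)]
            refine (hratio x hx y hy).trans (le_of_eq ?_)
            push_cast
            rw [show 2 * (η / 2) = η by ring]
            ring
          · simp [hy]
        · simp [hx])
    rw [lintegral_indicator hU, lintegral_indicator hU,
      lintegral_const_mul' _ _ ENNReal.ofReal_ne_top] at hPL
    have h1 : ∫⁻ x, ENNReal.ofReal (g x) = 1 := by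
      have := measure_univ (μ := γ)
      rwa [hγ, withDensity_apply _ .univ, setLIntegral_univ] at this
    have h2 : ENNReal.ofReal (1 - κ) ≤ ∫⁻ x in U, ENNReal.ofReal (w x) := by
      rw [← ofReal_integral_eq_lintegral_ofReal hwi.integrableOn (.of_forall hw0), ← hwS hU]
      exact ENNReal.ofReal_le_ofReal hπU1
    rw [h1, mul_one, ← ENNReal.ofReal_pow (Real.exp_pos _).le, ← Real.exp_nat_mul,
      show ((2 : ℕ) : ℝ) * (η / 2) = η by push_cast; ring] at hPL
    rw [ENNReal.ofReal_div_of_pos (by linarith), ENNReal.le_div_iff_mul_le (by simp [hκ1]) (by simp),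
      mul_comm]
    exact (mul_le_mul_left h2 _).trans hPL
  have hqm : Measurable fun x => g x ^ 2 / w x := by fun_prop
  have hqi : IntegrableOn (fun x => g x ^ 2 / w x) U := by
    refine ⟨hqm.aestronglyMeasurable, ?_⟩
    rw [hasFiniteIntegral_iff_ofReal (.of_forall fun x => div_nonneg (sq_nonneg _) (hw0 x))]
    exact hI.trans_lt ENNReal.ofReal_lt_top
  have hI' : ∫ x in U, g x ^ 2 / w x ≤ Real.exp η / (1 - κ) := by
    rw [integral_eq_lintegral_of_nonneg_ae
      (.of_forall fun x => div_nonneg (sq_nonneg _) (hw0 x)) hqm.aestronglyMeasurable]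
    exact ENNReal.toReal_le_of_le_ofReal
      (div_nonneg (Real.exp_pos _).le (by linarith)) hI
  have i1 : IntegrableOn (fun x => (t + 1 / t) * w x) U := hwi.integrableOn.const_mul _
  have i2 : IntegrableOn (fun x => -2 / t * g x) U := hgi.integrableOn.const_mul _
  have i3 : IntegrableOn (fun x => 1 / t * (g x ^ 2 / w x)) U := hqi.const_mul _
  have i4 : IntegrableOn (fun x => -2 / t * g x + 1 / t * (g x ^ 2 / w x)) U := i2.add i3
  have hL1 : ∫ x in U, |w x - g x|
      ≤ (t + (Real.exp η / (1 - κ) - 1 + 2 * κ) / t) / 2 := by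
    have hle : ∫ x in U, |w x - g x|
        ≤ ∫ x in U, ((t + 1 / t) * w x + (-2 / t * g x + 1 / t * (g x ^ 2 / w x))) / 2 := by
      refine setIntegral_mono_on (hwi.sub hgi).abs.integrableOn
        ((i1.add i4).div_const _) hU fun x hx => ?_
      have hwx := hwU x hx
      -- Weighted form of `2|w - g| ≤ t w + (w - g)²/(t w)`, with the square expanded so that each
      -- term integrates to a known quantity.
      have h2 : ((t + 1 / t) * w x + (-2 / t * g x + 1 / t * (g x ^ 2 / w x))) / 2
          - |w x - g x| = (t * w x - |w x - g x|) ^ 2 / (2 * t * w x) := by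
        rw [sub_sq, sq_abs]
        field_simp
        ring
      have h3 : 0 ≤ (t * w x - |w x - g x|) ^ 2 / (2 * t * w x) := by positivity
      linarith
    refine hle.trans ?_
    rw [integral_div, integral_add i1 i4, integral_add i2 i3, integral_const_mul,
      integral_const_mul, integral_const_mul, ← hwS hU, ← hgS hU]
    have hπ1 : π.real U ≤ 1 := measureReal_le_one
    refine div_le_div_of_nonneg_right ?_ zero_le_two
    rw [show t + (Real.exp η / (1 - κ) - 1 + 2 * κ) / t
      = (t * t + (Real.exp η / (1 - κ) - 1 + 2 * κ)) / t by field_simp, le_div_iff₀ ht]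
    have e : ((t + 1 / t) * π.real U + (-2 / t * γ.real U + 1 / t * ∫ x in U, g x ^ 2 / w x)) * t
        = t * t * π.real U + π.real U - 2 * γ.real U + ∫ x in U, g x ^ 2 / w x := by
      field_simp
      ring
    rw [e]
    nlinarith [mul_le_mul_of_nonneg_left hπ1 (mul_pos ht ht).le]
  refine ciSup_le fun ⟨A, hA⟩ => ?_
  have hsplit : ∀ μ : Measure (EuclideanSpace ℝ (Fin d)), IsProbabilityMeasure μ →
      μ.real A = μ.real (A ∩ U) + μ.real (A \ U) := fun μ _ =>
    (measureReal_inter_add_sdiff hU).symm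
  have hd : ∀ μ : Measure (EuclideanSpace ℝ (Fin d)), IsProbabilityMeasure μ →
      μ.real (A \ U) ≤ μ.real Uᶜ := fun μ _ => measureReal_mono fun x hx => hx.2
  have h1 : |π.real (A ∩ U) - γ.real (A ∩ U)| ≤ ∫ x in U, |w x - g x| := by
    rw [hwS (hA.inter hU), hgS (hA.inter hU), ← integral_sub hwi.integrableOn hgi.integrableOn]
    refine (abs_integral_le_integral_abs).trans ?_
    exact setIntegral_mono_set (hwi.sub hgi).abs.integrableOn
      (.of_forall fun x => abs_nonneg _) Set.inter_subset_right.eventuallyLE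
  have h2 : |π.real (A \ U) - γ.real (A \ U)| ≤ κ := by
    have := hd π inferInstance
    have := hd γ inferInstance
    have : 0 ≤ π.real (A \ U) := measureReal_nonneg
    have : 0 ≤ γ.real (A \ U) := measureReal_nonneg
    rw [abs_le]; constructor <;> linarith
  simp only [hsplit π inferInstance, hsplit γ inferInstance]
  calc |π.real (A ∩ U) + π.real (A \ U) - (γ.real (A ∩ U) + γ.real (A \ U))|
      = |(π.real (A ∩ U) - γ.real (A ∩ U)) + (π.real (A \ U) - γ.real (A \ U))| := by ring_nf
    _ ≤ _ := abs_add_le _ _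
    _ ≤ _ := by linarith

/-! ### Coordinates on the simplex and moments of multinomial counts -/

/-- The full vector of increments `(u₀, u₁, …, u_d)`, where `u₀ = - ∑ u_j`, as linear forms. -/
noncomputable def fullDir {d : ℕ} (j : Fin (d + 1)) : EuclideanSpace ℝ (Fin d) →L[ℝ] ℝ :=
  Fin.cons (α := fun _ => EuclideanSpace ℝ (Fin d) →L[ℝ] ℝ) (-∑ i, EuclideanSpace.proj i)
    (fun i => EuclideanSpace.proj i) j

variable {d : ℕ}

lemma fullDir_zero (u : EuclideanSpace ℝ (Fin d)) : fullDir 0 u = -∑ i, u i := by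
  simp [fullDir]

lemma fullDir_succ (u : EuclideanSpace ℝ (Fin d)) (i : Fin d) : fullDir i.succ u = u i := by
  simp [fullDir]

lemma fullPmf_eq (θ : EuclideanSpace ℝ (Fin d)) (j : Fin (d + 1)) :
    fullPmf θ j = fullPmf (0 : EuclideanSpace ℝ (Fin d)) j + fullDir j θ := by
  refine Fin.cases ?_ (fun i => ?_) j
  · simp [fullPmf, fullDir_zero, sub_eq_add_neg]
  · simp [fullPmf, fullDir_succ]

lemma fullPmf_sub (θ η : EuclideanSpace ℝ (Fin d)) (j : Fin (d + 1)) :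
    fullDir j (θ - η) = fullPmf θ j - fullPmf η j := by
  rw [fullPmf_eq θ, fullPmf_eq η, map_sub]; ring

lemma continuous_fullPmf (j : Fin (d + 1)) :
    Continuous fun θ : EuclideanSpace ℝ (Fin d) => fullPmf θ j := by
  rw [funext fun θ => fullPmf_eq θ j]; fun_prop

lemma sum_fullPmf (θ : EuclideanSpace ℝ (Fin d)) : ∑ j, fullPmf θ j = 1 := by
  simp [Fin.sum_univ_succ, fullPmf]

lemma mem_Theta_iff {θ : EuclideanSpace ℝ (Fin d)} : θ ∈ Theta d ↔ ∀ j, 0 < fullPmf θ j := by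
  simp [Theta, Fin.forall_fin_succ, fullPmf, and_comm]

lemma isOpen_Theta : IsOpen (Theta d) := by
  have : Theta d = ⋂ j, {θ | 0 < fullPmf θ j} := by ext; simp [mem_Theta_iff]
  rw [this]
  exact isOpen_iInter_of_finite fun j => isOpen_lt continuous_const (continuous_fullPmf j)

lemma fullPmf_le_one {θ : EuclideanSpace ℝ (Fin d)} (hθ : θ ∈ Theta d) (j : Fin (d + 1)) :
    fullPmf θ j ≤ 1 := by
  rw [← sum_fullPmf θ]
  exact Finset.single_le_sum (fun i _ => (mem_Theta_iff.1 hθ i).le) (Finset.mem_univ j)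

lemma isProbabilityMeasure_categorical {θ : EuclideanSpace ℝ (Fin d)} (hθ : θ ∈ Theta d) :
    IsProbabilityMeasure (categorical θ) := by
  constructor
  simp only [categorical, Measure.coe_finsetSum, Measure.coe_smul, Finset.sum_apply,
    Pi.smul_apply, measure_univ, smul_eq_mul, mul_one]
  rw [← ENNReal.ofReal_sum_of_nonneg fun j _ => (mem_Theta_iff.1 hθ j).le, sum_fullPmf,
    ENNReal.ofReal_one]

lemma integral_categorical {θ : EuclideanSpace ℝ (Fin d)} (hθ : θ ∈ Theta d)
    (f : Fin (d + 1) → ℝ) : ∫ x, f x ∂(categorical θ) = ∑ j, fullPmf θ j * f j := by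
  have := isProbabilityMeasure_categorical hθ
  rw [integral_fintype .of_finite]
  refine Finset.sum_congr rfl fun j _ => ?_
  congr 1
  rw [measureReal_def, categorical, Measure.finsetSum_apply]
  simp only [Measure.smul_apply, smul_eq_mul, Measure.dirac_apply' _ (measurableSet_singleton j)]
  rw [Finset.sum_eq_single j (fun i _ hij => by simp [hij]) (by simp)]
  simp [(mem_Theta_iff.1 hθ j).le]

lemma counts_eq_sum {n : ℕ} (j : Fin (d + 1)) (x : Fin n → Fin (d + 1)) :
    (counts x j : ℝ) = ∑ i, if x i = j then (1 : ℝ) else 0 := by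
  simp [counts]

lemma sum_counts {n : ℕ} (x : Fin n → Fin (d + 1)) : ∑ j, counts x j = n := by
  have := Finset.card_eq_sum_card_fiberwise (f := x) (s := Finset.univ) (t := Finset.univ)
    (fun _ _ => by simp)
  simpa [counts] using this.symm

lemma integral_counts {θ : EuclideanSpace ℝ (Fin d)} (hθ : θ ∈ Theta d) (n : ℕ)
    (j : Fin (d + 1)) :
    ∫ x, (counts x j : ℝ) ∂(Measure.pi fun _ : Fin n => categorical θ) = n * fullPmf θ j := by
  have := isProbabilityMeasure_categorical hθ
  simp_rw [counts_eq_sum]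
  rw [integral_finsetSum _ fun i _ => .of_finite]
  have : ∀ i : Fin n, ∫ x, (if x i = j then (1 : ℝ) else 0) ∂(Measure.pi fun _ => categorical θ)
      = fullPmf θ j := fun i => by
    rw [integral_comp_eval (μ := fun _ : Fin n => categorical θ) (i := i)
      (f := fun y => if y = j then (1 : ℝ) else 0) (Measurable.of_discrete.aestronglyMeasurable),
      integral_categorical hθ]
    simp
  simp [this]

lemma integral_counts_sub_sq {θ : EuclideanSpace ℝ (Fin d)} (hθ : θ ∈ Theta d) (n : ℕ)
    (j : Fin (d + 1)) :
    ∫ x, ((counts x j : ℝ) - n * fullPmf θ j) ^ 2 ∂(Measure.pi fun _ : Fin n => categorical θ)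
      = n * (fullPmf θ j * (1 - fullPmf θ j)) := by
  have := isProbabilityMeasure_categorical hθ
  have h1 := variance_sum_pi (μ := fun _ : Fin n => categorical θ)
    (X := fun _ y => if y = j then (1 : ℝ) else 0) (fun i => MemLp.of_discrete)
  have h2 : (∑ i : Fin n, fun x : Fin n → Fin (d + 1) => if x i = j then (1 : ℝ) else 0)
      = fun x => (counts x j : ℝ) := by
    ext x; simp [counts_eq_sum]
  rw [h2, variance_eq_integral Measurable.of_discrete.aemeasurable, integral_counts hθ] at h1
  rw [h1]
  have h3 : Var[fun y => if y = j then (1 : ℝ) else 0; categorical θ]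
      = fullPmf θ j * (1 - fullPmf θ j) := by
    rw [variance_eq_sub MemLp.of_discrete, integral_categorical hθ, integral_categorical hθ]
    simp
    ring
  simp [h3]

/-- Chebyshev bound for the chi-square statistic of a multinomial sample. -/
lemma one_sub_le_multinomial {θ : EuclideanSpace ℝ (Fin d)} (hθ : θ ∈ Theta d) {n : ℕ}
    (hn : 0 < n) (hd : 0 < d) {K : ℝ} (hK : 0 < K) :
    1 - ENNReal.ofReal (1 / K ^ 2) ≤ multinomial n θ {N | ∑ j, N j = n ∧
      ∑ j, ((N j : ℝ) / n - fullPmf θ j) ^ 2 / fullPmf θ j ≤ K ^ 2 * (d / n)} := by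
  have := isProbabilityMeasure_categorical hθ
  have hn' : (0 : ℝ) < n := by exact_mod_cast hn
  have hd' : (0 : ℝ) < d := by exact_mod_cast hd
  set P := Measure.pi fun _ : Fin n => categorical θ with hP
  set X : (Fin n → Fin (d + 1)) → ℝ := fun x =>
    ∑ j, ((counts x j : ℝ) / n - fullPmf θ j) ^ 2 / fullPmf θ j with hX
  have hX0 : ∀ x, 0 ≤ X x := fun x => Finset.sum_nonneg fun j _ =>
    div_nonneg (sq_nonneg _) (mem_Theta_iff.1 hθ j).le
  have hEX : ∫ x, X x ∂P = d / n := by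
    have e : ∀ x, X x = ∑ j, (1 / (n ^ 2 * fullPmf θ j)) *
        ((counts x j : ℝ) - n * fullPmf θ j) ^ 2 := fun x => by
      refine Finset.sum_congr rfl fun j _ => ?_
      have := (mem_Theta_iff.1 hθ j).ne'
      field_simp
    simp_rw [e]
    rw [integral_finsetSum _ fun i _ => .of_finite]
    simp_rw [integral_const_mul, hP, integral_counts_sub_sq hθ]
    -- The `d + 1` terms `(1 - θ_j)/n` add up to `d/n`, whatever the size of the smallest
    -- probability.
    have e2 : ∀ j, 1 / (n ^ 2 * fullPmf θ j) * (n * (fullPmf θ j * (1 - fullPmf θ j)))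
        = (1 - fullPmf θ j) / n := fun j => by
      have := (mem_Theta_iff.1 hθ j).ne'
      field_simp
    simp_rw [e2]
    rw [← Finset.sum_div, Finset.sum_sub_distrib, sum_fullPmf]
    simp
  rw [multinomial, Measure.map_apply Measurable.of_discrete .of_discrete, ← hP]
  set G := counts ⁻¹' {N : Fin (d + 1) → ℕ | ∑ j, N j = n ∧
      ∑ j, ((N j : ℝ) / n - fullPmf θ j) ^ 2 / fullPmf θ j ≤ K ^ 2 * (d / n)} with hG
  have hsub : Gᶜ ⊆ {x | K ^ 2 * (d / n) ≤ X x} := fun x hx => by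
    simp only [hG, Set.mem_compl_iff, Set.mem_preimage, Set.mem_ofPred_eq, sum_counts, true_and,
      not_le] at hx
    exact hx.le
  have hmarkov := mul_meas_ge_le_integral_of_nonneg (μ := P) (f := X) (.of_forall hX0) .of_finite
    (K ^ 2 * (d / n))
  rw [hEX] at hmarkov
  have h1 : P.real Gᶜ ≤ 1 / K ^ 2 := by
    refine (measureReal_mono hsub).trans ?_
    have hp : 0 < K ^ 2 * ((d : ℝ) / n) := by positivity
    rw [← mul_le_mul_iff_right₀ hp]
    refine hmarkov.trans (le_of_eq ?_)
    field_simp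
  have h2 : P Gᶜ ≤ ENNReal.ofReal (1 / K ^ 2) := by
    rw [← ofReal_measureReal]; exact ENNReal.ofReal_le_ofReal h1
  rw [prob_compl_eq_one_sub .of_discrete] at h2
  exact tsub_le_iff_tsub_le.1 h2

/-! ### Population log likelihood and Fisher information -/

lemma log_likelihood {θ : EuclideanSpace ℝ (Fin d)} (hθ : θ ∈ Theta d) (N : Fin (d + 1) → ℕ) :
    Real.log (likelihood N θ) = ∑ j, (N j : ℝ) * Real.log (fullPmf θ j) := by
  rw [likelihood, Real.log_prod fun j _ => pow_ne_zero _ (mem_Theta_iff.1 hθ j).ne']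
  simp

lemma popNll_eq {θs θ : EuclideanSpace ℝ (Fin d)} (hθs : θs ∈ Theta d) (hθ : θ ∈ Theta d) {n : ℕ}
    (hn : 0 < n) : popNll n θs θ = ∑ j, -fullPmf θs j * Real.log (fullPmf θ j) := by
  have := isProbabilityMeasure_categorical hθs
  have hn' : (n : ℝ) ≠ 0 := by exact_mod_cast hn.ne'
  rw [popNll, multinomial, integral_map Measurable.of_discrete.aemeasurable
    Measurable.of_discrete.aestronglyMeasurable]
  simp_rw [nll, log_likelihood hθ]
  rw [integral_const_mul, integral_finsetSum _ fun i _ => .of_finite]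
  simp_rw [integral_mul_const, integral_counts hθs, Finset.mul_sum]
  refine Finset.sum_congr rfl fun j _ => ?_
  field_simp

lemma hasFDerivAt_fullPmf (θ : EuclideanSpace ℝ (Fin d)) (j : Fin (d + 1)) :
    HasFDerivAt (fun θ : EuclideanSpace ℝ (Fin d) => fullPmf θ j) (fullDir j) θ := by
  rw [funext fun θ => fullPmf_eq θ j]
  exact (fullDir j).hasFDerivAt.const_add _

/-- On the open set `Theta d` the population loss is the cross-entropy `-∑ θ*_j log θ_j`, with each
`θ_j` affine in the free parameters. The second derivative has weights `θ*_j / θ_j²`, which become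
`1/θ*_j` at the truth. -/
lemma fisher_apply {θs : EuclideanSpace ℝ (Fin d)} (hθs : θs ∈ Theta d) {n : ℕ} (hn : 0 < n)
    (i k : Fin d) : fisher n θs i k = ∑ j, (fullPmf θs j)⁻¹ *
      (fullDir j (EuclideanSpace.single i 1) * fullDir j (EuclideanSpace.single k 1)) := by
  have hmem : ∀ᶠ θ in 𝓝 θs, θ ∈ Theta d := isOpen_Theta.mem_nhds hθs
  have h1 : popNll n θs =ᶠ[𝓝 θs] fun θ => ∑ j, -fullPmf θs j * Real.log (fullPmf θ j) :=
    hmem.mono fun θ hθ => popNll_eq hθs hθ hn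
  have h2 : fderiv ℝ (popNll n θs) =ᶠ[𝓝 θs] fun θ =>
      ∑ j, (-fullPmf θs j * (fullPmf θ j)⁻¹) • fullDir j := by
    refine h1.fderiv.trans (hmem.mono fun θ hθ => ?_)
    refine HasFDerivAt.fderiv ?_
    refine HasFDerivAt.fun_sum fun j _ => ?_
    rw [mul_smul]
    exact ((hasFDerivAt_fullPmf θ j).log (mem_Theta_iff.1 hθ j).ne').const_mul _
  have h3 : HasFDerivAt (fun θ => ∑ j, (-fullPmf θs j * (fullPmf θ j)⁻¹) •
      (fullDir j : EuclideanSpace ℝ (Fin d) →L[ℝ] ℝ))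
      (∑ j, ((-fullPmf θs j) • (-(fullPmf θs j ^ 2)⁻¹ • fullDir j)).smulRight (fullDir j)) θs := by
    refine HasFDerivAt.fun_sum fun j _ => ?_
    have h0 := (mem_Theta_iff.1 hθs j).ne'
    exact (((hasDerivAt_inv h0).comp_hasFDerivAt θs (hasFDerivAt_fullPmf θs j)).const_mul
      (-fullPmf θs j)).smul_const (fullDir j)
  rw [fisher, hessian, Matrix.of_apply, iteratedFDeriv_two_apply, h2.fderiv_eq, h3.fderiv]
  simp only [Matrix.cons_val_zero, Matrix.cons_val_one, sum_apply,
    ContinuousLinearMap.smulRight_apply, smul_apply, smul_eq_mul]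
  refine Finset.sum_congr rfl fun j _ => ?_
  have h0 := (mem_Theta_iff.1 hθs j).ne'
  field_simp

lemma fullDir_eq_sum (u : EuclideanSpace ℝ (Fin d)) (j : Fin (d + 1)) :
    fullDir j u = ∑ i, u i * fullDir j (EuclideanSpace.single i 1) := by
  conv_lhs => rw [← (EuclideanSpace.basisFun (Fin d) ℝ).sum_repr u]
  simp

lemma dotProduct_fisher_mulVec {θs : EuclideanSpace ℝ (Fin d)} (hθs : θs ∈ Theta d) {n : ℕ}
    (hn : 0 < n) (u : EuclideanSpace ℝ (Fin d)) :
    u.ofLp ⬝ᵥ (fisher n θs *ᵥ u.ofLp) = ∑ j, fullDir j u ^ 2 / fullPmf θs j := by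
  simp only [dotProduct, Matrix.mulVec, fisher_apply hθs hn]
  simp_rw [Finset.sum_mul, Finset.mul_sum]
  rw [Finset.sum_congr rfl fun i _ => Finset.sum_comm, Finset.sum_comm]
  refine Finset.sum_congr rfl fun j _ => ?_
  rw [fullDir_eq_sum u j, pow_two, Finset.sum_mul_sum, Finset.sum_div]
  refine Finset.sum_congr rfl fun i _ => ?_
  rw [Finset.sum_div]
  refine Finset.sum_congr rfl fun k _ => ?_
  rw [div_eq_mul_inv]
  ring

lemma posDef_fisher {θs : EuclideanSpace ℝ (Fin d)} (hθs : θs ∈ Theta d) {n : ℕ}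
    (hn : 0 < n) : (fisher n θs).PosDef := by
  refine Matrix.PosDef.of_dotProduct_mulVec_pos ?_ fun x hx => ?_
  · ext i k
    simp only [Matrix.conjTranspose_apply, fisher_apply hθs hn, star_trivial]
    exact Finset.sum_congr rfl fun j _ => by ring
  · have := dotProduct_fisher_mulVec hθs hn (WithLp.toLp 2 x)
    simp only [star_trivial]
    simp only at this
    rw [this]
    obtain ⟨i, hi⟩ := Function.ne_iff.1 hx
    refine Finset.sum_pos' (fun j _ => div_nonneg (sq_nonneg _) (mem_Theta_iff.1 hθs j).le)
      ⟨i.succ, Finset.mem_univ _, div_pos ?_ (mem_Theta_iff.1 hθs _)⟩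
    rw [fullDir_succ]
    exact sq_pos_of_ne_zero hi

/-! ### Weighted-sum estimates for the log likelihood -/

section WeightedSums

variable {ι : Type*} [Fintype ι] {p h x y : ι → ℝ} {m r : ℝ}

lemma sum_sq_div_sub_le (hp : ∀ j, 0 < p j) (x y z : ι → ℝ) :
    ∑ j, (x j - z j) ^ 2 / p j
      ≤ 2 * ∑ j, (x j - y j) ^ 2 / p j + 2 * ∑ j, (z j - y j) ^ 2 / p j := by
  rw [Finset.mul_sum, Finset.mul_sum, ← Finset.sum_add_distrib]
  refine Finset.sum_le_sum fun j _ => ?_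
  rw [← mul_div_assoc, ← mul_div_assoc, ← add_div]
  refine div_le_div_of_nonneg_right ?_ (hp j).le
  nlinarith [sq_nonneg (x j - y j + (z j - y j))]

/-- A single term gives `u_j² ≤ r p_j ≤ r p_j²/m`. This passage from the Fisher norm to uniform
relative error is how the smallest probability enters the rate. -/
lemma abs_le_of_sum_sq_div_le (hm : 0 < m) (hp : ∀ j, m ≤ p j) {u : ι → ℝ}
    (hu : ∑ j, u j ^ 2 / p j ≤ r) (j : ι) : |u j| ≤ p j * √(r / m) := by
  have hpj : 0 < p j := hm.trans_le (hp j)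
  have h1 : u j ^ 2 / p j ≤ r := (Finset.single_le_sum (f := fun j => u j ^ 2 / p j)
    (fun i _ => div_nonneg (sq_nonneg _) (hm.le.trans (hp i))) (Finset.mem_univ j)).trans hu
  have hr : 0 ≤ r := le_trans (by positivity) h1
  refine abs_le_of_sq_le_sq ?_ (by positivity)
  rw [mul_pow, Real.sq_sqrt (by positivity)]
  rw [div_le_iff₀ hpj] at h1
  calc u j ^ 2 ≤ r * p j := h1
    _ = r * p j * m / m := by field_simp
    _ ≤ r * p j * p j / m := by gcongr; exact hp j
    _ = _ := by ring

lemma sum_abs_mul_abs_div_le (hp : ∀ j, 0 < p j) (u v : ι → ℝ) :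
    ∑ j, |u j| * |v j| / p j ≤ √(∑ j, u j ^ 2 / p j) * √(∑ j, v j ^ 2 / p j) := by
  have := Real.sum_mul_le_sqrt_mul_sqrt Finset.univ (fun j => |u j| / √(p j))
    (fun j => |v j| / √(p j))
  simp only [div_pow, sq_abs, Real.sq_sqrt (hp _).le] at this
  convert this using 2 with j
  rw [div_mul_div_comm, Real.mul_self_sqrt (hp j).le]

/-- The logarithm of the likelihood differs from its quadratic approximation by a function which
is Lipschitz near the centre, with a small constant. -/
lemma sum_mul_log_add_quadratic_sub_le (hm : 0 < m) (hp : ∀ j, m ≤ p j) (hr : r ≤ m / 25)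
    (hxy : ∑ j, x j = ∑ j, y j) (hx : ∑ j, (x j - p j) ^ 2 / p j ≤ r)
    (hy : ∑ j, (y j - p j) ^ 2 / p j ≤ r) (hh : ∑ j, (h j - p j) ^ 2 / p j ≤ r) :
    ∑ j, (h j * Real.log (x j) + (x j - h j) ^ 2 / (2 * p j))
      - ∑ j, (h j * Real.log (y j) + (y j - h j) ^ 2 / (2 * p j))
      ≤ 4 * r / √m * √(∑ j, (x j - y j) ^ 2 / p j) := by
  have hp0 : ∀ j, 0 < p j := fun j => hm.trans_le (hp j)
  have hr0 : 0 ≤ r := le_trans (Finset.sum_nonneg fun j _ => div_nonneg (sq_nonneg _) (hp0 j).le) hh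
  set z : ℝ → ι → ℝ := fun t j => y j + t * (x j - y j) with hz
  have hzr : ∀ t ∈ Set.Icc (0 : ℝ) 1, ∑ j, (z t j - p j) ^ 2 / p j ≤ r := by
    intro t ht
    calc ∑ j, (z t j - p j) ^ 2 / p j
        ≤ ∑ j, ((1 - t) * ((y j - p j) ^ 2 / p j) + t * ((x j - p j) ^ 2 / p j)) := by
          refine Finset.sum_le_sum fun j _ => ?_
          rw [← mul_div_assoc, ← mul_div_assoc, ← add_div]
          refine div_le_div_of_nonneg_right ?_ (hp0 j).le
          simp only [hz]
          nlinarith [mul_nonneg (mul_nonneg ht.1 (sub_nonneg.2 ht.2)) (sq_nonneg (x j - y j))]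
      _ = (1 - t) * ∑ j, (y j - p j) ^ 2 / p j + t * ∑ j, (x j - p j) ^ 2 / p j := by
          rw [Finset.sum_add_distrib, Finset.mul_sum, Finset.mul_sum]
      _ ≤ (1 - t) * r + t * r := by
          have := ht.1
          have : 0 ≤ 1 - t := sub_nonneg.2 ht.2
          gcongr
      _ = r := by ring
  have hsq : √(r / m) ≤ 1 / 5 := by
    rw [Real.sqrt_le_left (by norm_num), div_le_iff₀ hm]
    linarith
  have hzp : ∀ t ∈ Set.Icc (0 : ℝ) 1, ∀ j, p j / 2 ≤ z t j := by
    intro t ht j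
    have h1 := abs_le_of_sum_sq_div_le hm hp (hzr t ht) j
    have h2 : p j * √(r / m) ≤ p j * (1 / 5) := by have := hp0 j; gcongr
    have := (abs_le.1 (h1.trans h2)).1
    linarith [hp0 j]
  have hz0 : ∀ t ∈ Set.Icc (0 : ℝ) 1, ∀ j, 0 < z t j := fun t ht j =>
    lt_of_lt_of_le (half_pos (hp0 j)) (hzp t ht j)
  have hderiv : ∀ t ∈ Set.Icc (0 : ℝ) 1, HasDerivAt
      (fun t => ∑ j, (h j * Real.log (z t j) + (z t j - h j) ^ 2 / (2 * p j)))
      (∑ j, (h j * ((x j - y j) / z t j) + (z t j - h j) * (x j - y j) / p j)) t := by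
    intro t ht
    refine HasDerivAt.fun_sum fun j _ => ?_
    have hzd : HasDerivAt (fun t => z t j) (x j - y j) t := by
      simpa [hz] using (((hasDerivAt_id t).mul_const (x j - y j)).const_add (y j) :)
    refine ((hzd.log (hz0 t ht j).ne').const_mul _).add ?_
    refine (((hzd.sub_const (h j)).fun_pow 2).div_const (2 * p j)).congr_deriv ?_
    rw [Nat.cast_ofNat, pow_one, mul_assoc, mul_div_mul_left _ _ two_ne_zero]
  obtain ⟨t, ht, hslope⟩ := exists_hasDerivAt_eq_slope _ _ zero_lt_one
    (fun t ht => (hderiv t ht).continuousAt.continuousWithinAt)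
    (fun t ht => hderiv t (Set.Ioo_subset_Icc_self ht))
  have ht' := Set.Ioo_subset_Icc_self ht
  have e0 : z 0 = y := by ext; simp [hz]
  have e1 : z 1 = x := by ext; simp [hz]
  rw [e0, e1, sub_zero, div_one] at hslope
  rw [← hslope]
  have hsum0 : ∑ j, (x j - y j) = 0 := by rw [Finset.sum_sub_distrib, hxy, sub_self]
  -- Subtracting `∑ (x_j - y_j) = 0` cancels the zeroth-order term: `h/z - 1 + (z - h)/p = (z - h)(z
  -- - p)/(p z)`, a product of two small deviations. The factor `x - y` is then bounded uniformly
  -- and the other two by Cauchy–Schwarz.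
  have e2 : ∑ j, (h j * ((x j - y j) / z t j) + (z t j - h j) * (x j - y j) / p j)
      = ∑ j, (x j - y j) * (z t j - h j) * (z t j - p j) / (p j * z t j) := by
    rw [← sub_zero (∑ j, _), ← hsum0, ← Finset.sum_sub_distrib]
    refine Finset.sum_congr rfl fun j _ => ?_
    have := (hp0 j).ne'
    have := (hz0 t ht' j).ne'
    field_simp
    ring
  rw [e2]
  set Q := ∑ j, (x j - y j) ^ 2 / p j with hQ
  have hQ0 : 0 ≤ Q := Finset.sum_nonneg fun j _ => div_nonneg (sq_nonneg _) (hp0 j).le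
  calc ∑ j, (x j - y j) * (z t j - h j) * (z t j - p j) / (p j * z t j)
      ≤ ∑ j, 2 * √(Q / m) * (|z t j - h j| * |z t j - p j| / p j) := by
        refine Finset.sum_le_sum fun j _ => ?_
        have hpj := hp0 j
        have hzj := hz0 t ht' j
        have h1 := abs_le_of_sum_sq_div_le hm hp (u := fun j => x j - y j) hQ.ge j
        refine (le_abs_self _).trans ?_
        rw [abs_div, abs_mul, abs_mul, abs_of_pos (mul_pos hpj hzj), div_le_iff₀ (by positivity)]
        calc |x j - y j| * |z t j - h j| * |z t j - p j|
            ≤ (p j * √(Q / m)) * |z t j - h j| * |z t j - p j| := by gcongr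
          _ = 2 * √(Q / m) * (|z t j - h j| * |z t j - p j| / p j) * (p j * (p j / 2)) := by
              field_simp
          _ ≤ _ := by gcongr; exact hzp t ht' j
    _ = 2 * √(Q / m) * ∑ j, |z t j - h j| * |z t j - p j| / p j := by rw [Finset.mul_sum]
    _ ≤ 2 * √(Q / m) * (√(4 * r) * √r) := by
        gcongr
        refine (sum_abs_mul_abs_div_le hp0 (fun j => z t j - h j) fun j => z t j - p j).trans ?_
        have h1 := sum_sq_div_sub_le hp0 (z t) p h
        have h2 := hzr t ht'
        gcongr
        linarith
    _ = _ := by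
        rw [Real.sqrt_mul (by norm_num), mul_assoc (√4), Real.mul_self_sqrt hr0, Real.sqrt_div hQ0,
          show √(4 : ℝ) = 2 by rw [show (4 : ℝ) = 2 ^ 2 by norm_num]; simp]
        ring

lemma log_one_add_le_sub_sq {v : ℝ} (hv : |v| ≤ 1 / 5) : Real.log (1 + v) ≤ v - v ^ 2 / 4 := by
  have h1 := Real.abs_log_sub_add_sum_range_le (x := -v) (by rw [abs_neg]; linarith) 2
  simp only [Finset.sum_range_succ, Finset.sum_range_zero, abs_neg, sub_neg_eq_add] at h1
  have h2 : |v| ^ (2 + 1) / (1 - |v|) ≤ v ^ 2 / 4 := by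
    rw [div_le_iff₀ (by linarith), ← sq_abs v]
    nlinarith [sq_nonneg |v|, abs_nonneg v]
  have h3 := (abs_le.1 (h1.trans h2)).2
  norm_num at h3
  linarith

/-- Decay of the likelihood away from its maximizer. -/
lemma sum_mul_log_sub_le (hm : 0 < m) (hp : ∀ j, m ≤ p j) (hr : r ≤ m / 25)
    (hr0 : 0 < r) (hhx : ∑ j, h j = ∑ j, x j) (hx0 : ∀ j, 0 < x j)
    (hh : ∑ j, (h j - p j) ^ 2 / p j ≤ r) (hxh : r / 4 ≤ ∑ j, (x j - h j) ^ 2 / p j) :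
    ∑ j, h j * Real.log (x j) ≤ ∑ j, h j * Real.log (h j) - r / 32 := by
  have hp0 : ∀ j, 0 < p j := fun j => hm.trans_le (hp j)
  have hsq : √(r / m) ≤ 1 / 5 := by
    rw [Real.sqrt_le_left (by norm_num), div_le_iff₀ hm]
    linarith
  have hhp : ∀ j, p j / 2 ≤ h j ∧ h j ≤ 2 * p j := by
    intro j
    have h1 := abs_le_of_sum_sq_div_le hm hp hh j
    have h2 : p j * √(r / m) ≤ p j * (1 / 5) := by have := hp0 j; gcongr
    have := abs_le.1 (h1.trans h2)
    constructor <;> linarith [hp0 j]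
  have hh0 : ∀ j, 0 < h j := fun j => lt_of_lt_of_le (half_pos (hp0 j)) (hhp j).1
  set Q := ∑ j, (x j - h j) ^ 2 / p j with hQ
  have hQ0 : 0 < Q := by linarith
  -- Contracting `x` towards `h` by `t ≤ 1` brings it to squared distance exactly `r/4`, where every
  -- relative deviation `v_j` is at most `1/5` and a quadratic bound on `log (1 + v)` holds.
  -- Concavity of the logarithm carries the decay back out to `x`.
  set t := √(r / 4 / Q) with ht
  have ht0 : 0 < t := by positivity
  have ht1 : t ≤ 1 := by
    rw [ht, Real.sqrt_le_one, div_le_one hQ0]; exact hxh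
  have ht2 : t ^ 2 * Q = r / 4 := by
    rw [ht, Real.sq_sqrt (by positivity)]; field_simp
  set v : ι → ℝ := fun j => t * (x j - h j) / h j with hv
  have hvQ : ∑ j, (t * (x j - h j)) ^ 2 / p j = r / 4 := by
    rw [← ht2, hQ, Finset.mul_sum]
    exact Finset.sum_congr rfl fun j _ => by ring
  have hvle : ∀ j, |v j| ≤ 1 / 5 := by
    intro j
    have h1 := abs_le_of_sum_sq_div_le hm hp hvQ.le j
    simp only [hv]
    rw [abs_div, abs_of_pos (hh0 j), div_le_iff₀ (hh0 j)]
    have h3 : √(r / 4 / m) = √(r / m) / 2 := by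
      rw [show r / 4 / m = r / m / 2 ^ 2 by ring, Real.sqrt_div (by positivity),
        Real.sqrt_sq (by norm_num)]
    rw [h3] at h1
    have h2 : p j * (√(r / m) / 2) ≤ p j * (1 / 5 / 2) := by have := hp0 j; gcongr
    linarith [(hhp j).1]
  have hconc : ∀ j, t * (Real.log (x j) - Real.log (h j)) ≤ Real.log (1 + v j) := by
    intro j
    have h1 := strictConcaveOn_log_Ioi.concaveOn.2 (hx0 j) (hh0 j) ht0.le
      (sub_nonneg.2 ht1) (by ring)
    have h2 : t • x j + (1 - t) • h j = h j * (1 + v j) := by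
      simp only [hv, smul_eq_mul]
      have := (hh0 j).ne'
      field_simp
      ring
    have h3 : 0 < 1 + v j := by linarith [(abs_le.1 (hvle j)).1]
    rw [h2, Real.log_mul (hh0 j).ne' h3.ne'] at h1
    simp only [smul_eq_mul] at h1
    linarith
  have hD : t * (∑ j, h j * Real.log (x j) - ∑ j, h j * Real.log (h j)) ≤ -(r / 32) := by
    calc t * (∑ j, h j * Real.log (x j) - ∑ j, h j * Real.log (h j))
        = ∑ j, h j * (t * (Real.log (x j) - Real.log (h j))) := by
          rw [← Finset.sum_sub_distrib, Finset.mul_sum]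
          exact Finset.sum_congr rfl fun j _ => by ring
      _ ≤ ∑ j, h j * (v j - v j ^ 2 / 4) := by
          refine Finset.sum_le_sum fun j _ => mul_le_mul_of_nonneg_left ?_ (hh0 j).le
          exact (hconc j).trans (log_one_add_le_sub_sq (hvle j))
      _ = t * ∑ j, (x j - h j) - ∑ j, (t * (x j - h j)) ^ 2 / h j / 4 := by
          rw [Finset.mul_sum, ← Finset.sum_sub_distrib]
          refine Finset.sum_congr rfl fun j _ => ?_
          simp only [hv]
          have := (hh0 j).ne'
          field_simp
      _ = -∑ j, (t * (x j - h j)) ^ 2 / h j / 4 := by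
          rw [Finset.sum_sub_distrib, hhx, sub_self, mul_zero, zero_sub]
      -- Replacing `h_j` by its bound `2 p_j` costs a factor two, so the final gain is `(r/4)/8 =
      -- r/32`.
      _ ≤ -∑ j, (t * (x j - h j)) ^ 2 / p j / 8 := by
          refine neg_le_neg (Finset.sum_le_sum fun j _ => ?_)
          rw [div_div, div_div]
          have := hh0 j
          refine div_le_div_of_nonneg_left (sq_nonneg _) (by positivity) ?_
          linarith [(hhp j).2]
      _ = _ := by rw [← Finset.sum_div, hvQ]; ring
  nlinarith

end WeightedSums

/-! ### Fisher norm, Fisher balls and the prior -/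

/-- The squared Fisher norm `∑_j u_j² / θ_j` of a direction. -/
noncomputable def chiSq (θs u : EuclideanSpace ℝ (Fin d)) : ℝ :=
  ∑ j, fullDir j u ^ 2 / fullPmf θs j

lemma chiSq_sub (θs x y : EuclideanSpace ℝ (Fin d)) :
    chiSq θs (x - y) = ∑ j, (fullPmf x j - fullPmf y j) ^ 2 / fullPmf θs j := by
  simp_rw [chiSq, fullPmf_sub]

lemma chiSq_smul (θs u : EuclideanSpace ℝ (Fin d)) (c : ℝ) :
    chiSq θs (c • u) = c ^ 2 * chiSq θs u := by
  simp_rw [chiSq, map_smul, smul_eq_mul, mul_pow, mul_div_assoc, Finset.mul_sum]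

lemma chiSq_nonneg {θs : EuclideanSpace ℝ (Fin d)} (hθs : θs ∈ Theta d)
    (u : EuclideanSpace ℝ (Fin d)) : 0 ≤ chiSq θs u :=
  Finset.sum_nonneg fun j _ => div_nonneg (sq_nonneg _) (mem_Theta_iff.1 hθs j).le

lemma continuous_chiSq (θs : EuclideanSpace ℝ (Fin d)) : Continuous (chiSq θs) := by
  unfold chiSq; fun_prop

lemma chiSq_parallelogram (θs a b : EuclideanSpace ℝ (Fin d)) :
    chiSq θs a + chiSq θs b
      = 2 * chiSq θs ((1 / 2 : ℝ) • (a + b)) + 1 / 2 * chiSq θs (a - b) := by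
  simp_rw [chiSq, Finset.mul_sum, ← Finset.sum_add_distrib]
  refine Finset.sum_congr rfl fun j _ => ?_
  simp only [map_smul, map_add, map_sub, smul_eq_mul]
  ring

lemma wNorm_fisher {θs : EuclideanSpace ℝ (Fin d)} (hθs : θs ∈ Theta d) {n : ℕ} (hn : 0 < n)
    (u : EuclideanSpace ℝ (Fin d)) : wNorm (fisher n θs) u = √(chiSq θs u) := by
  rw [wNorm, dotProduct_fisher_mulVec hθs hn, chiSq]

lemma mem_nbhd_iff {θs : EuclideanSpace ℝ (Fin d)} (hθs : θs ∈ Theta d) {n : ℕ} (hn : 0 < n)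
    {s : ℝ} (hs : 0 ≤ s) (θ : EuclideanSpace ℝ (Fin d)) :
    θ ∈ nbhd n θs s ↔ chiSq θs (θ - θs) ≤ s ^ 2 * (d / n) := by
  rw [nbhd, Set.mem_ofPred_eq, wNorm_fisher hθs hn, Real.sqrt_le_left (by positivity), mul_pow,
    Real.sq_sqrt (by positivity)]

lemma isClosed_nbhd {θs : EuclideanSpace ℝ (Fin d)} (hθs : θs ∈ Theta d) {n : ℕ} (hn : 0 < n)
    {s : ℝ} (hs : 0 ≤ s) : IsClosed (nbhd n θs s) := by
  have : nbhd n θs s = {θ | chiSq θs (θ - θs) ≤ s ^ 2 * (d / n)} := by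
    ext θ; exact mem_nbhd_iff hθs hn hs θ
  rw [this]
  have := continuous_chiSq θs
  exact isClosed_le (by fun_prop) continuous_const

lemma convex_nbhd {θs : EuclideanSpace ℝ (Fin d)} (hθs : θs ∈ Theta d) {n : ℕ} (hn : 0 < n)
    {s : ℝ} (hs : 0 ≤ s) : Convex ℝ (nbhd n θs s) := by
  intro x hx y hy a b ha hb hab
  rw [mem_nbhd_iff hθs hn hs] at hx hy ⊢
  have e : a • x + b • y - θs = a • (x - θs) + b • (y - θs) := by
    rw [smul_sub, smul_sub, sub_add_sub_comm, ← add_smul, hab, one_smul]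
  calc chiSq θs (a • x + b • y - θs) ≤ a * chiSq θs (x - θs) + b * chiSq θs (y - θs) := by
        rw [e]
        simp_rw [chiSq, Finset.mul_sum, ← Finset.sum_add_distrib]
        refine Finset.sum_le_sum fun j _ => ?_
        rw [← mul_div_assoc, ← mul_div_assoc, ← add_div]
        refine div_le_div_of_nonneg_right ?_ (mem_Theta_iff.1 hθs j).le
        simp only [map_add, map_smul, smul_eq_mul]
        obtain rfl : b = 1 - a := by linarith
        nlinarith [mul_nonneg (mul_nonneg ha hb)
          (sq_nonneg (fullDir j (x - θs) - fullDir j (y - θs)))]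
    _ ≤ a * (s ^ 2 * (d / n)) + b * (s ^ 2 * (d / n)) := by gcongr
    _ = _ := by rw [← add_mul, hab, one_mul]

lemma chiSq_eq_zero {θs : EuclideanSpace ℝ (Fin d)} (hθs : θs ∈ Theta d)
    {u : EuclideanSpace ℝ (Fin d)} (h : chiSq θs u = 0) : u = 0 := by
  rw [chiSq, Finset.sum_eq_zero_iff_of_nonneg fun j _ =>
    div_nonneg (sq_nonneg _) (mem_Theta_iff.1 hθs j).le] at h
  ext i
  have := h i.succ (Finset.mem_univ _)
  rw [div_eq_zero_iff, or_iff_left (mem_Theta_iff.1 hθs _).ne', fullDir_succ] at this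
  simpa using this

lemma le_mul_wNorm_of_dualNorm_le {θs : EuclideanSpace ℝ (Fin d)} (hθs : θs ∈ Theta d) {n : ℕ}
    (hn : 0 < n) {S : EuclideanSpace ℝ (Fin d) →L[ℝ] ℝ} {δ : ℝ} (hδ : 0 ≤ δ)
    (hS : dualNorm (fisher n θs) S ≤ ENNReal.ofReal δ) (u : EuclideanSpace ℝ (Fin d)) :
    S u ≤ δ * √(chiSq θs u) := by
  rcases (chiSq_nonneg hθs u).eq_or_lt with h0 | h0
  · rw [chiSq_eq_zero hθs h0.symm, map_zero]; positivity
  have hc : 0 < √(chiSq θs u) := Real.sqrt_pos.2 h0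
  have h1 : wNorm (fisher n θs) ((√(chiSq θs u))⁻¹ • u) = 1 := by
    rw [wNorm_fisher hθs hn, chiSq_smul, inv_pow, Real.sq_sqrt h0.le, inv_mul_cancel₀ h0.ne',
      Real.sqrt_one]
  have h2 : ENNReal.ofReal (S ((√(chiSq θs u))⁻¹ • u)) ≤ ENNReal.ofReal δ :=
    (le_iSup₂ (f := fun (v : EuclideanSpace ℝ (Fin d)) (_ : wNorm (fisher n θs) v = 1) =>
      ENNReal.ofReal (S v)) _ h1).trans hS
  rw [ENNReal.ofReal_le_ofReal_iff hδ, map_smul, smul_eq_mul, inv_mul_le_iff₀ hc, mul_comm] at h2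
  exact h2

lemma prior_of_delta01_le {θs : EuclideanSpace ℝ (Fin d)} {n : ℕ}
    {ρ : EuclideanSpace ℝ (Fin d) → ℝ} {s δ : ℝ}
    (hδ : delta01 n ρ θs s ≤ ENNReal.ofReal δ) {θ : EuclideanSpace ℝ (Fin d)}
    (hθ : θ ∈ nbhd n θs s) :
    ContDiffAt ℝ 1 ρ θ ∧ 0 < ρ θ ∧
      dualNorm (fisher n θs) (fderiv ℝ (fun η => Real.log (ρ η)) θ) ≤ ENNReal.ofReal δ := by
  rw [delta01] at hδ
  split_ifs at hδ with h
  · exact ⟨(h θ hθ).1, (h θ hθ).2, (le_iSup₂ (f := fun (v : EuclideanSpace ℝ (Fin d))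
      (_ : v ∈ nbhd n θs s) => dualNorm (fisher n θs) (fderiv ℝ (fun η => Real.log (ρ η)) v))
      θ hθ).trans hδ⟩
  · simp at hδ

/-- The logarithm of the prior is Lipschitz in the Fisher norm. -/
lemma log_prior_sub_le {θs : EuclideanSpace ℝ (Fin d)} (hθs : θs ∈ Theta d) {n : ℕ} (hn : 0 < n)
    {ρ : EuclideanSpace ℝ (Fin d) → ℝ} {s δ : ℝ} (hs : 0 ≤ s) (hδ0 : 0 ≤ δ)
    (hδ : delta01 n ρ θs s ≤ ENNReal.ofReal δ) {x y : EuclideanSpace ℝ (Fin d)}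
    (hx : x ∈ nbhd n θs s) (hy : y ∈ nbhd n θs s) :
    Real.log (ρ x) - Real.log (ρ y) ≤ δ * √(chiSq θs (x - y)) := by
  have hz : ∀ t ∈ Set.Icc (0 : ℝ) 1, y + t • (x - y) ∈ nbhd n θs s := fun t ht =>
    (convex_nbhd hθs hn hs).add_smul_sub_mem hy hx ht
  have hderiv : ∀ t ∈ Set.Icc (0 : ℝ) 1,
      HasDerivAt (fun t : ℝ => Real.log (ρ (y + t • (x - y))))
        (fderiv ℝ (fun η => Real.log (ρ η)) (y + t • (x - y)) (x - y)) t := by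
    intro t ht
    obtain ⟨h1, h2, -⟩ := prior_of_delta01_le hδ (hz t ht)
    have h3 : DifferentiableAt ℝ (fun η => Real.log (ρ η)) (y + t • (x - y)) :=
      (h1.differentiableAt one_ne_zero).log h2.ne'
    have h4 : HasDerivAt (fun t : ℝ => y + t • (x - y)) (x - y) t := by
      simpa using (((hasDerivAt_id t).smul_const (x - y)).const_add y :)
    exact h3.hasFDerivAt.comp_hasDerivAt t h4
  obtain ⟨t, ht, hslope⟩ := exists_hasDerivAt_eq_slope _ _ zero_lt_one
    (fun t ht => (hderiv t ht).continuousAt.continuousWithinAt)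
    (fun t ht => hderiv t (Set.Ioo_subset_Icc_self ht))
  simp only [one_smul, add_sub_cancel, zero_smul, add_zero, sub_zero, div_one] at hslope
  rw [← hslope]
  exact le_mul_wNorm_of_dualNorm_le hθs hn hδ0
    (prior_of_delta01_le hδ (hz t (Set.Ioo_subset_Icc_self ht))).2.2 _

lemma thetaMin_pos {θs : EuclideanSpace ℝ (Fin d)} (hθs : θs ∈ Theta d) : 0 < thetaMin θs := by
  obtain ⟨j, hj⟩ := exists_eq_ciInf_of_finite (f := fullPmf θs)
  rw [thetaMin, ← hj]
  exact mem_Theta_iff.1 hθs j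

lemma thetaMin_le (θs : EuclideanSpace ℝ (Fin d)) (j : Fin (d + 1)) :
    thetaMin θs ≤ fullPmf θs j :=
  ciInf_le (Set.finite_range _).bddBelow j

/-- At this radius each coordinate has relative error at most `1/5`, so it stays positive. Applied
to Fisher balls and to the empirical frequencies. -/
lemma mem_Theta_of_chiSq_le {θs : EuclideanSpace ℝ (Fin d)} (hθs : θs ∈ Theta d)
    {θ : EuclideanSpace ℝ (Fin d)} (h : chiSq θs (θ - θs) ≤ thetaMin θs / 25) : θ ∈ Theta d := by
  rw [chiSq_sub] at h
  have hm := thetaMin_pos hθs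
  refine mem_Theta_iff.2 fun j => ?_
  have h1 := abs_le_of_sum_sq_div_le (u := fun j => fullPmf θ j - fullPmf θs j) hm
    (thetaMin_le θs) h j
  have h2 : √(thetaMin θs / 25 / thetaMin θs) ≤ 1 / 5 := by
    rw [Real.sqrt_le_left (by norm_num), div_right_comm, div_self hm.ne']
    norm_num
  have hp := mem_Theta_iff.1 hθs j
  have h3 : fullPmf θs j * √(thetaMin θs / 25 / thetaMin θs) ≤ fullPmf θs j * (1 / 5) := by gcongr
  have := (abs_le.1 (h1.trans h3)).1
  linarith

/-! ### The likelihood, its maximizer and its integral -/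

lemma likelihood_pos {θ : EuclideanSpace ℝ (Fin d)} (hθ : θ ∈ Theta d) (N : Fin (d + 1) → ℕ) :
    0 < likelihood N θ :=
  Finset.prod_pos fun j _ => pow_pos (mem_Theta_iff.1 hθ j) _

lemma likelihood_le_one {θ : EuclideanSpace ℝ (Fin d)} (hθ : θ ∈ Theta d) (N : Fin (d + 1) → ℕ) :
    likelihood N θ ≤ 1 :=
  Finset.prod_le_one (fun j _ => pow_nonneg (mem_Theta_iff.1 hθ j).le _)
    fun j _ => pow_le_one₀ (mem_Theta_iff.1 hθ j).le (fullPmf_le_one hθ j)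

lemma continuous_likelihood (N : Fin (d + 1) → ℕ) :
    Continuous fun θ : EuclideanSpace ℝ (Fin d) => likelihood N θ :=
  continuous_finsetProd _ fun j _ => (continuous_fullPmf j).pow _

lemma exp_neg_mul_nll {θ : EuclideanSpace ℝ (Fin d)} (hθ : θ ∈ Theta d) (N : Fin (d + 1) → ℕ)
    {n : ℕ} (hn : 0 < n) : Real.exp (-(n * nll n N θ)) = likelihood N θ := by
  have hn' : (n : ℝ) ≠ 0 := by exact_mod_cast hn.ne'
  rw [nll, show -((n : ℝ) * (-(1 / n) * Real.log (likelihood N θ)))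
    = Real.log (likelihood N θ) by field_simp, Real.exp_log (likelihood_pos hθ N)]

/-- The maximum likelihood estimator: the vector of empirical frequencies. -/
noncomputable def empirical (n : ℕ) (N : Fin (d + 1) → ℕ) : EuclideanSpace ℝ (Fin d) :=
  WithLp.toLp 2 fun i => (N i.succ : ℝ) / n

lemma fullPmf_empirical {n : ℕ} (hn : 0 < n) {N : Fin (d + 1) → ℕ} (hN : ∑ j, N j = n)
    (j : Fin (d + 1)) : fullPmf (empirical n N) j = N j / n := by
  have hn' : (n : ℝ) ≠ 0 := by exact_mod_cast hn.ne'
  refine Fin.cases ?_ (fun i => ?_) j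
  · have h : (N 0 : ℝ) + ∑ i : Fin d, (N i.succ : ℝ) = n := by
      rw [Fin.sum_univ_succ] at hN; exact_mod_cast hN
    simp only [fullPmf, empirical, Fin.cons_zero, ← Finset.sum_div]
    field_simp
    linarith
  · simp [fullPmf, empirical]

lemma natCast_eq_mul_fullPmf {n : ℕ} (hn : 0 < n) {N : Fin (d + 1) → ℕ} (hN : ∑ j, N j = n)
    (j : Fin (d + 1)) : (N j : ℝ) = n * fullPmf (empirical n N) j := by
  have hn' : (n : ℝ) ≠ 0 := by exact_mod_cast hn.ne'
  rw [fullPmf_empirical hn hN, mul_div_cancel₀ _ hn']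

lemma log_likelihood_eq {n : ℕ} (hn : 0 < n) {N : Fin (d + 1) → ℕ} (hN : ∑ j, N j = n)
    {θ : EuclideanSpace ℝ (Fin d)} (hθ : θ ∈ Theta d) : Real.log (likelihood N θ)
      = n * ∑ j, fullPmf (empirical n N) j * Real.log (fullPmf θ j) := by
  rw [log_likelihood hθ, Finset.mul_sum]
  refine Finset.sum_congr rfl fun j _ => ?_
  rw [natCast_eq_mul_fullPmf hn hN, mul_assoc]

/-- Gibbs' inequality: `log t ≤ t - 1` at `t = θ_j / θh_j`, strict in some coordinate where the two
differ; the linear terms sum to zero. -/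
lemma isUniqueMLE_empirical {n : ℕ} (hn : 0 < n) {N : Fin (d + 1) → ℕ} (hN : ∑ j, N j = n)
    (hmem : empirical n N ∈ Theta d) : IsUniqueMLE n N (empirical n N) := by
  refine ⟨hmem, fun θ hθ hne => ?_⟩
  have hn' : (0 : ℝ) < n := by exact_mod_cast hn
  rw [nll, nll, log_likelihood_eq hn hN hθ, log_likelihood_eq hn hN hmem]
  suffices h : ∑ j, fullPmf (empirical n N) j * Real.log (fullPmf θ j)
      < ∑ j, fullPmf (empirical n N) j * Real.log (fullPmf (empirical n N) j) by
    field_simp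
    linarith
  have hterm : ∀ j, fullPmf (empirical n N) j * Real.log (fullPmf θ j) ≤
      fullPmf (empirical n N) j * Real.log (fullPmf (empirical n N) j)
        + (fullPmf θ j - fullPmf (empirical n N) j) := by
    intro j
    have h1 := mem_Theta_iff.1 hθ j
    have h2 := mem_Theta_iff.1 hmem j
    have := Real.log_le_sub_one_of_pos (div_pos h1 h2)
    rw [Real.log_div h1.ne' h2.ne'] at this
    have := mul_le_mul_of_nonneg_left this h2.le
    rw [mul_sub, mul_sub, mul_div_cancel₀ _ h2.ne'] at this
    linarith
  have hex : ∃ j, fullPmf θ j ≠ fullPmf (empirical n N) j := by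
    by_contra! hall
    refine hne (PiLp.ext fun i => ?_)
    simpa [fullPmf] using hall i.succ
  obtain ⟨j, hj⟩ := hex
  calc ∑ j, fullPmf (empirical n N) j * Real.log (fullPmf θ j)
      < ∑ j, (fullPmf (empirical n N) j * Real.log (fullPmf (empirical n N) j)
        + (fullPmf θ j - fullPmf (empirical n N) j)) := by
        refine Finset.sum_lt_sum (fun j _ => hterm j) ⟨j, Finset.mem_univ _, ?_⟩
        have h1 := mem_Theta_iff.1 hθ j
        have h2 := mem_Theta_iff.1 hmem j
        have := Real.log_lt_sub_one_of_pos (div_pos h1 h2) (by rwa [ne_eq, div_eq_one_iff_eq h2.ne'])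
        rw [Real.log_div h1.ne' h2.ne'] at this
        have := mul_lt_mul_of_pos_left this h2
        rw [mul_sub, mul_sub, mul_div_cancel₀ _ h2.ne'] at this
        linarith
    _ = _ := by
        rw [Finset.sum_add_distrib, Finset.sum_sub_distrib, sum_fullPmf, sum_fullPmf, sub_self,
          add_zero]

lemma volume_Theta_lt_top : volume (Theta d) < ⊤ := by
  refine (measure_mono fun θ hθ => ?_).trans_lt
    (measure_closedBall_lt_top (x := (0 : EuclideanSpace ℝ (Fin d))) (r := 1))
  rw [mem_closedBall_zero_iff, ← sq_le_one_iff₀ (norm_nonneg _), EuclideanSpace.real_norm_sq_eq]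
  refine le_trans (Finset.sum_le_sum fun j _ => ?_) hθ.2.le
  have h1 := hθ.1 j
  have h2 := fullPmf_le_one hθ j.succ
  simp only [fullPmf, Fin.cons_succ] at h2
  nlinarith

/-- A tail bound for a density passes to a comparable density. -/
lemma setLIntegral_compl_le_of_comparable {α : Type*} [MeasurableSpace α] {μ : Measure α}
    {f w : α → ℝ} {U : Set α} (hU : MeasurableSet U) {κ M c : ℝ} (hκ0 : 0 ≤ κ) (hκ : κ ≤ 1 / 2)
    (hM : 0 ≤ M) (hc : 0 < c) (hwM : ∀ x ∈ Uᶜ, w x ≤ M * f x) (hwc : ∀ x ∈ U, c * f x ≤ w x)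
    (hfin : ∫⁻ x, ENNReal.ofReal (f x) ∂μ ≠ ⊤)
    (htail : ∫⁻ x in Uᶜ, ENNReal.ofReal (f x) ∂μ
      ≤ ENNReal.ofReal κ * ∫⁻ x, ENNReal.ofReal (f x) ∂μ) :
    ∫⁻ x in Uᶜ, ENNReal.ofReal (w x) ∂μ
      ≤ ENNReal.ofReal (2 * M * κ / c) * ∫⁻ x in U, ENNReal.ofReal (w x) ∂μ := by
  set F := ∫⁻ x, ENNReal.ofReal (f x) ∂μ with hF
  set A := ∫⁻ x in U, ENNReal.ofReal (f x) ∂μ with hA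
  set B := ∫⁻ x in Uᶜ, ENNReal.ofReal (f x) ∂μ with hB
  have hAB : A + B = F := lintegral_add_compl _ hU
  have hAt : A ≠ ⊤ := ne_top_of_le_ne_top hfin (hAB ▸ le_self_add)
  have hBt : B ≠ ⊤ := ne_top_of_le_ne_top hfin (hAB ▸ le_add_self)
  have h1 : F ≤ ENNReal.ofReal 2 * A := by
    have hB' : B.toReal ≤ κ * F.toReal := by
      have := ENNReal.toReal_mono (ENNReal.mul_ne_top ENNReal.ofReal_ne_top hfin) htail
      rwa [ENNReal.toReal_mul, ENNReal.toReal_ofReal hκ0] at this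
    have hsum : A.toReal + B.toReal = F.toReal := by rw [← ENNReal.toReal_add hAt hBt, hAB]
    rw [← ENNReal.ofReal_toReal hfin, ← ENNReal.ofReal_toReal hAt,
      ← ENNReal.ofReal_mul (by norm_num)]
    refine ENNReal.ofReal_le_ofReal ?_
    have : 0 ≤ F.toReal := ENNReal.toReal_nonneg
    nlinarith
  have h2 : ENNReal.ofReal c * A ≤ ∫⁻ x in U, ENNReal.ofReal (w x) ∂μ := by
    rw [hA, ← lintegral_const_mul' _ _ ENNReal.ofReal_ne_top]
    refine setLIntegral_mono' hU fun x hx => ?_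
    rw [← ENNReal.ofReal_mul hc.le]
    exact ENNReal.ofReal_le_ofReal (hwc x hx)
  calc ∫⁻ x in Uᶜ, ENNReal.ofReal (w x) ∂μ ≤ ENNReal.ofReal M * B := by
        rw [hB, ← lintegral_const_mul' _ _ ENNReal.ofReal_ne_top]
        refine setLIntegral_mono' hU.compl fun x hx => ?_
        rw [← ENNReal.ofReal_mul hM]
        exact ENNReal.ofReal_le_ofReal (hwM x hx)
    _ ≤ ENNReal.ofReal M * (ENNReal.ofReal κ * (ENNReal.ofReal 2 * A)) := by
        gcongr; exact htail.trans (by gcongr)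
    _ = ENNReal.ofReal (2 * M * κ / c) * (ENNReal.ofReal c * A) := by
        rw [← mul_assoc, ← mul_assoc, ← mul_assoc, ← ENNReal.ofReal_mul hM,
          ← ENNReal.ofReal_mul (by positivity), ← ENNReal.ofReal_mul (by positivity)]
        congr 2
        field_simp
    _ ≤ _ := by gcongr

/-- The likelihood, extended by zero outside the parameter space. -/
noncomputable def likelihoodOn (N : Fin (d + 1) → ℕ) : EuclideanSpace ℝ (Fin d) → ℝ :=
  (Theta d).indicator fun θ => likelihood N θ

lemma measurable_likelihoodOn (N : Fin (d + 1) → ℕ) : Measurable (likelihoodOn (d := d) N) :=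
  (continuous_likelihood N).measurable.indicator isOpen_Theta.measurableSet

lemma likelihoodOn_nonneg (N : Fin (d + 1) → ℕ) (θ : EuclideanSpace ℝ (Fin d)) :
    0 ≤ likelihoodOn N θ :=
  Set.indicator_nonneg (fun _ hθ => (likelihood_pos hθ N).le) θ

lemma lintegral_likelihoodOn_ne_top (N : Fin (d + 1) → ℕ) :
    ∫⁻ θ : EuclideanSpace ℝ (Fin d), ENNReal.ofReal (likelihoodOn N θ) ≠ ⊤ := by
  refine ne_top_of_le_ne_top (volume_Theta_lt_top (d := d)).ne ?_
  rw [← lintegral_indicator_one isOpen_Theta.measurableSet]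
  refine lintegral_mono fun θ => ?_
  by_cases hθ : θ ∈ Theta d
  · simpa [likelihoodOn, hθ] using likelihood_le_one hθ N
  · simp [likelihoodOn, hθ]

lemma lintegral_likelihoodOn_pos (N : Fin (d + 1) → ℕ) (hne : (Theta d).Nonempty) :
    0 < ∫⁻ θ : EuclideanSpace ℝ (Fin d), ENNReal.ofReal (likelihoodOn N θ) := by
  rw [lintegral_pos_iff_support (measurable_likelihoodOn N).ennreal_ofReal]
  refine (isOpen_Theta.measure_pos volume hne).trans_le (measure_mono fun θ hθ => ?_)
  simpa [likelihoodOn, hθ] using likelihood_pos hθ N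

lemma add_smul_sub_mem_Theta {x c : EuclideanSpace ℝ (Fin d)} (hx : x ∈ Theta d)
    (hc : c ∈ Theta d) : c + (1 / 2 : ℝ) • (x - c) ∈ Theta d ∧
      ∀ j, fullPmf (c + (1 / 2 : ℝ) • (x - c)) j = (fullPmf x j + fullPmf c j) / 2 := by
  have h : ∀ j, fullPmf (c + (1 / 2 : ℝ) • (x - c)) j = (fullPmf x j + fullPmf c j) / 2 := by
    intro j
    rw [fullPmf_eq, map_add, map_smul, fullPmf_sub, fullPmf_eq c, fullPmf_eq x, smul_eq_mul]
    ring
  refine ⟨mem_Theta_iff.2 fun j => ?_, h⟩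
  rw [h]
  have := mem_Theta_iff.1 hx j
  have := mem_Theta_iff.1 hc j
  positivity

/-- Arithmetic–geometric mean in each coordinate. Extension by zero preserves the inequality because
the parameter space is convex; this feeds the tail bound. -/
lemma likelihoodOn_mul_le_sq (N : Fin (d + 1) → ℕ) {c : EuclideanSpace ℝ (Fin d)}
    (hc : c ∈ Theta d) (x : EuclideanSpace ℝ (Fin d)) :
    likelihoodOn N x * likelihood N c ≤ likelihoodOn N (c + (1 / 2 : ℝ) • (x - c)) ^ 2 := by
  by_cases hx : x ∈ Theta d
  · obtain ⟨h1, h2⟩ := add_smul_sub_mem_Theta hx hc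
    simp only [likelihoodOn, Set.indicator_of_mem hx, Set.indicator_of_mem h1, likelihood, h2]
    rw [← Finset.prod_mul_distrib, ← Finset.prod_pow]
    refine Finset.prod_le_prod (fun j _ => ?_) fun j _ => ?_
    · have := mem_Theta_iff.1 hx j
      have := mem_Theta_iff.1 hc j
      positivity
    · have := mem_Theta_iff.1 hx j
      have := mem_Theta_iff.1 hc j
      rw [← mul_pow, ← pow_mul, mul_comm (N j), pow_mul]
      refine pow_le_pow_left₀ (by positivity) ?_ _
      nlinarith [sq_nonneg (fullPmf x j - fullPmf c j)]
  · simp only [likelihoodOn, Set.indicator_of_notMem hx, zero_mul]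
    positivity

/-! ### Deterministic bounds when the empirical frequencies are close to the truth -/

section Deterministic

variable {n : ℕ} {θs : EuclideanSpace ℝ (Fin d)} {N : Fin (d + 1) → ℕ} {s : ℝ}

/-- Triangle inequality: the estimator lies within half the radius of the truth, so points outside
the ball are at least half the radius from it. -/
lemma le_chiSq_sub_of_notMem (hθs : θs ∈ Theta d) (hn : 0 < n) (hs : 0 ≤ s)
    {θh x : EuclideanSpace ℝ (Fin d)} (hθh : 4 * chiSq θs (θh - θs) ≤ s ^ 2 * (d / n))
    (hx : x ∈ (nbhd n θs s)ᶜ) : s ^ 2 * (d / n) / 4 ≤ chiSq θs (x - θh) := by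
  rw [Set.mem_compl_iff, mem_nbhd_iff hθs hn hs, not_le] at hx
  have h := sum_sq_div_sub_le (mem_Theta_iff.1 hθs) (fullPmf x) (fullPmf θh) (fullPmf θs)
  have h2 : chiSq θs (θh - θs) = ∑ j, (fullPmf θs j - fullPmf θh j) ^ 2 / fullPmf θs j := by
    rw [chiSq_sub]; exact Finset.sum_congr rfl fun j _ => by ring
  rw [← h2, ← chiSq_sub, ← chiSq_sub] at h
  linarith

lemma likelihoodOn_le (hθs : θs ∈ Theta d) (hd : 0 < d) (hn : 0 < n) (hN : ∑ j, N j = n)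
    (hs : 0 < s) (hsmall : s ^ 2 * (d / n) ≤ thetaMin θs / 25)
    (hhat : 4 * chiSq θs (empirical n N - θs) ≤ s ^ 2 * (d / n))
    {x : EuclideanSpace ℝ (Fin d)} (hx : x ∈ (nbhd n θs s)ᶜ) :
    likelihoodOn N x ≤ Real.exp (-(s ^ 2 * d / 32)) * likelihood N (empirical n N) := by
  have hn' : (0 : ℝ) < n := by exact_mod_cast hn
  have hd' : (0 : ℝ) < d := by exact_mod_cast hd
  have hq0 := chiSq_nonneg hθs (empirical n N - θs)
  have hmem : empirical n N ∈ Theta d := mem_Theta_of_chiSq_le hθs (by linarith)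
  by_cases hxΘ : x ∈ Theta d
  · have h1 := le_chiSq_sub_of_notMem hθs hn hs.le hhat hx
    rw [chiSq_sub] at h1
    have h2 := sum_mul_log_sub_le (thetaMin_pos hθs) (thetaMin_le θs) hsmall (by positivity)
      (by rw [sum_fullPmf, sum_fullPmf]) (mem_Theta_iff.1 hxΘ)
      (by rw [← chiSq_sub]; linarith) h1
    rw [likelihoodOn, Set.indicator_of_mem hxΘ, ← Real.exp_log (likelihood_pos hxΘ N),
      ← Real.exp_log (likelihood_pos hmem N), ← Real.exp_add, Real.exp_le_exp,
      log_likelihood_eq hn hN hxΘ, log_likelihood_eq hn hN hmem]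
    have h3 := mul_le_mul_of_nonneg_left h2 hn'.le
    have h4 : (n : ℝ) * (s ^ 2 * (d / n) / 32) = s ^ 2 * d / 32 := by field_simp
    rw [mul_sub, h4] at h3
    linarith
  · rw [likelihoodOn, Set.indicator_of_notMem hxΘ]
    have := likelihood_pos hmem N
    positivity

lemma setLIntegral_likelihoodOn_le (hθs : θs ∈ Theta d) (hd : 0 < d) (hn : 0 < n)
    (hN : ∑ j, N j = n) (hs : 0 < s) (hsmall : s ^ 2 * (d / n) ≤ thetaMin θs / 25)
    (hhat : 4 * chiSq θs (empirical n N - θs) ≤ s ^ 2 * (d / n)) :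
    ∫⁻ x in (nbhd n θs s)ᶜ, ENNReal.ofReal (likelihoodOn N x)
      ≤ ENNReal.ofReal (Real.exp (-(s ^ 2 * d / 32) / 2) * 2 ^ d)
        * ∫⁻ x, ENNReal.ofReal (likelihoodOn N x) := by
  have hq0 := chiSq_nonneg hθs (empirical n N - θs)
  have hmem : empirical n N ∈ Theta d := mem_Theta_of_chiSq_le hθs (by linarith)
  exact setLIntegral_le_of_le_sq_midpoint (measurable_likelihoodOn N) (likelihoodOn_nonneg N)
    (empirical n N) (likelihoodOn_mul_le_sq N hmem) (isClosed_nbhd hθs hn hs.le).measurableSet.compl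
    fun x hx => likelihoodOn_le hθs hd hn hN hs hsmall hhat hx

lemma gaussian_density (hθs : θs ∈ Theta d) (hn : 0 < n) (θh : EuclideanSpace ℝ (Fin d)) :
    ∃ k : ℝ, 0 < k ∧ gammaStar n θs θh = volume.withDensity (fun x =>
      ENNReal.ofReal (k * Real.exp (-(n * chiSq θs (x - θh)) / 2))) := by
  have hn' : (0 : ℝ) < n := by exact_mod_cast hn
  obtain ⟨k, hk, h⟩ := multivariateGaussian_inv_eq_withDensity
    ((posDef_fisher hθs hn).smul hn') θh
  refine ⟨k, hk, ?_⟩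
  rw [gammaStar, h]
  simp_rw [Matrix.smul_mulVec, dotProduct_smul, dotProduct_fisher_mulVec hθs hn, smul_eq_mul]
  rfl

/-- The tail argument for the likelihood applies to the Gaussian too. Its true log-deficit outside
the ball is `s² d / 8`; the weaker `s² d / 32` is used so that both tails share one bound. -/
lemma gammaStar_compl_le (hθs : θs ∈ Theta d) (hn : 0 < n) (hs : 0 ≤ s)
    {θh : EuclideanSpace ℝ (Fin d)} (hhat : 4 * chiSq θs (θh - θs) ≤ s ^ 2 * (d / n)) :
    gammaStar n θs θh (nbhd n θs s)ᶜ
      ≤ ENNReal.ofReal (Real.exp (-(s ^ 2 * d / 32) / 2) * 2 ^ d) := by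
  have hn' : (0 : ℝ) < n := by exact_mod_cast hn
  obtain ⟨k, hk, hγ⟩ := gaussian_density hθs hn θh
  have hprob : gammaStar n θs θh Set.univ = 1 := by
    rw [gammaStar]; exact measure_univ
  have hUm := (isClosed_nbhd hθs hn hs).measurableSet.compl
  have hcont := continuous_chiSq θs
  have h := setLIntegral_le_of_le_sq_midpoint (a := s ^ 2 * d / 32) (m := k)
    (f := fun x => k * Real.exp (-(n * chiSq θs (x - θh)) / 2)) (by fun_prop)
    (fun x => by positivity) θh (fun x => by
      rw [add_sub_cancel_left, chiSq_smul, mul_pow, ← Real.exp_nat_mul, mul_right_comm, ← pow_two]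
      refine mul_le_mul_of_nonneg_left (Real.exp_le_exp.2 ?_) (sq_nonneg k)
      have := mul_nonneg hn'.le (chiSq_nonneg hθs (x - θh))
      push_cast
      linarith) hUm (fun x hx => by
      rw [mul_comm]
      refine mul_le_mul_of_nonneg_right (Real.exp_le_exp.2 ?_) hk.le
      have h1 := mul_le_mul_of_nonneg_left (le_chiSq_sub_of_notMem hθs hn hs hhat hx) hn'.le
      have h4 : (n : ℝ) * (s ^ 2 * (d / n) / 4) = s ^ 2 * d / 4 := by field_simp
      rw [h4] at h1
      have : 0 ≤ s ^ 2 * d := by positivity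
      linarith)
  rw [← withDensity_apply _ hUm, ← hγ, ← setLIntegral_univ, ← withDensity_apply _ .univ, ← hγ,
    hprob, mul_one] at h
  exact h

lemma unnormPosterior_eq (hn : 0 < n) (ρ : EuclideanSpace ℝ (Fin d) → ℝ) :
    unnormPosterior n ρ N
      = volume.withDensity fun θ => ENNReal.ofReal (likelihoodOn N θ * ρ θ) := by
  have h : (fun θ => ENNReal.ofReal (likelihoodOn N θ * ρ θ)) = (Theta d).indicator
      fun θ => ENNReal.ofReal (Real.exp (-(n * nll n N θ)) * ρ θ) := by
    ext θ
    by_cases hθ : θ ∈ Theta d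
    · simp [likelihoodOn, hθ, exp_neg_mul_nll hθ N hn]
    · simp [likelihoodOn, hθ]
  rw [h, withDensity_indicator isOpen_Theta.measurableSet]
  rfl

end Deterministic

lemma chiSq_sub_comm (θs x y : EuclideanSpace ℝ (Fin d)) :
    chiSq θs (x - y) = chiSq θs (y - x) := by
  rw [← neg_sub, ← neg_one_smul ℝ, chiSq_smul]; norm_num

section Deterministic

variable {n : ℕ} {θs : EuclideanSpace ℝ (Fin d)} {N : Fin (d + 1) → ℕ} {s : ℝ}
  {ρ : EuclideanSpace ℝ (Fin d) → ℝ}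

/-- The log prior varies from its central value by at most `δ s √(d/n) ≤ √d ≤ d`. A loss of `e^(-d)`
is affordable because the tails decay like `e^(-c s² d)`. -/
lemma exp_neg_mul_prior_le (hθs : θs ∈ Theta d) (hd : 0 < d) (hn : 0 < n) (hs : 0 < s) {δ : ℝ}
    (hδ0 : 0 ≤ δ) (hδ : delta01 n ρ θs s ≤ ENNReal.ofReal δ) (hδs : δ * s ≤ √n)
    {x : EuclideanSpace ℝ (Fin d)} (hx : x ∈ nbhd n θs s) :
    Real.exp (-d) * ρ θs ≤ ρ x := by
  have hn' : (0 : ℝ) < n := by exact_mod_cast hn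
  have hd' : (1 : ℝ) ≤ d := by exact_mod_cast hd
  have hθsU : θs ∈ nbhd n θs s := by
    rw [mem_nbhd_iff hθs hn hs.le, sub_self]
    simp only [chiSq, map_zero]
    simp
    positivity
  have hx0 := (prior_of_delta01_le hδ hx).2.1
  have hs0 := (prior_of_delta01_le hδ hθsU).2.1
  have h1 := log_prior_sub_le hθs hn hs.le hδ0 hδ hθsU hx
  have h2 : δ * √(chiSq θs (θs - x)) ≤ d := by
    calc δ * √(chiSq θs (θs - x)) ≤ δ * √(s ^ 2 * (d / n)) := by
          gcongr
          rw [chiSq_sub_comm]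
          exact (mem_nbhd_iff hθs hn hs.le x).1 hx
      _ = δ * s * √d / √n := by
          rw [Real.sqrt_mul (sq_nonneg s), Real.sqrt_sq hs.le, Real.sqrt_div (by positivity)]
          ring
      _ ≤ √n * √d / √n := by gcongr
      _ = √d := by have : 0 < √(n : ℝ) := Real.sqrt_pos.2 hn'
                   field_simp
      _ ≤ d := Real.sqrt_le_left (by positivity) |>.2 (by nlinarith)
  calc Real.exp (-d) * ρ θs = Real.exp (-d + Real.log (ρ θs)) := by
        rw [Real.exp_add, Real.exp_log hs0]
    _ ≤ Real.exp (Real.log (ρ x)) := Real.exp_le_exp.2 (by linarith)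
    _ = ρ x := Real.exp_log hx0

/-- Logarithmic form of the midpoint condition with `η = E²`. The likelihood remainder and the log
prior are both Lipschitz in the Fisher norm, and the parallelogram gain `-n Q / 4` pays for them. -/
lemma log_posterior_oscillation (hθs : θs ∈ Theta d) (hn : 0 < n)
    (hN : ∑ j, N j = n) (hs : 0 < s) (hsmall : s ^ 2 * (d / n) ≤ thetaMin θs / 25)
    (hhat : chiSq θs (empirical n N - θs) ≤ s ^ 2 * (d / n)) {δ : ℝ}
    (hδ0 : 0 ≤ δ) (hδ : delta01 n ρ θs s ≤ ENNReal.ofReal δ)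
    {x y : EuclideanSpace ℝ (Fin d)} (hx : x ∈ nbhd n θs s) (hy : y ∈ nbhd n θs s) :
    (Real.log (likelihood N x) + Real.log (ρ x)) - (Real.log (likelihood N y) + Real.log (ρ y))
      - n * chiSq θs (y - empirical n N)
      ≤ (4 * s ^ 2 * (d / √(n * thetaMin θs)) + δ / √n) ^ 2
        - n * chiSq θs ((1 / 2 : ℝ) • (x + y) - empirical n N) := by
  have hn' : (0 : ℝ) < n := by exact_mod_cast hn
  have hm := thetaMin_pos hθs
  have hx' := (mem_nbhd_iff hθs hn hs.le x).1 hx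
  have hy' := (mem_nbhd_iff hθs hn hs.le y).1 hy
  have hxΘ := mem_Theta_of_chiSq_le hθs (hx'.trans hsmall)
  have hyΘ := mem_Theta_of_chiSq_le hθs (hy'.trans hsmall)
  have h1 := log_prior_sub_le hθs hn hs.le hδ0 hδ hx hy
  rw [chiSq_sub] at hx' hy' hhat
  have h2 := mul_le_mul_of_nonneg_left (sum_mul_log_add_quadratic_sub_le hm (thetaMin_le θs) hsmall
    (by rw [sum_fullPmf, sum_fullPmf]) hx' hy' hhat) hn'.le
  have hquad : ∀ {z}, z ∈ Theta d →
      n * ∑ j, (fullPmf (empirical n N) j * Real.log (fullPmf z j)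
        + (fullPmf z j - fullPmf (empirical n N) j) ^ 2 / (2 * fullPmf θs j))
      = Real.log (likelihood N z) + n / 2 * chiSq θs (z - empirical n N) := by
    intro z hz
    rw [log_likelihood_eq hn hN hz, Finset.sum_add_distrib, mul_add, chiSq_sub]
    congr 1
    rw [Finset.mul_sum, Finset.mul_sum]
    refine Finset.sum_congr rfl fun j _ => ?_
    have := (mem_Theta_iff.1 hθs j).ne'
    field_simp
  rw [mul_sub, hquad hxΘ, hquad hyΘ, ← chiSq_sub] at h2
  have hpar := chiSq_parallelogram θs (x - empirical n N) (y - empirical n N)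
  rw [sub_sub_sub_cancel_right, show (1 / 2 : ℝ) • (x - empirical n N + (y - empirical n N))
    = (1 / 2 : ℝ) • (x + y) - empirical n N by module] at hpar
  set Q := chiSq θs (x - y) with hQ
  have hQ0 : 0 ≤ Q := chiSq_nonneg hθs _
  have hsn : 0 < √(n : ℝ) := Real.sqrt_pos.2 hn'
  have hsm : 0 < √(thetaMin θs) := Real.sqrt_pos.2 hm
  set E := 4 * s ^ 2 * (d / √(n * thetaMin θs)) + δ / √n with hE
  have hlin : n * (4 * (s ^ 2 * (d / n)) / √(thetaMin θs) * √Q) + δ * √Q = E * (√n * √Q) := by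
    rw [hE, Real.sqrt_mul hn'.le]
    field_simp
  have hz2 : (√(n : ℝ) * √Q) ^ 2 = n * Q := by
    rw [mul_pow, Real.sq_sqrt hn'.le, Real.sq_sqrt hQ0]
  -- Completing the square: `E z - z²/4 ≤ E²` with `z = √n √Q`.
  nlinarith [sq_nonneg (E - √n * √Q / 2)]

/-- Total variation bound for the posterior on the event that the maximum likelihood estimator
is close to the ground truth. -/
lemma tvDist_posterior_le (hθs : θs ∈ Theta d) (hd : 0 < d) (hn : 0 < n) (hN : ∑ j, N j = n)
    (hs : 0 < s) (hsmall : s ^ 2 * (d / n) ≤ thetaMin θs / 25)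
    (hhat : 4 * chiSq θs (empirical n N - θs) ≤ s ^ 2 * (d / n))
    (hρm : Measurable ρ) (hρ0 : ∀ θ, 0 ≤ ρ θ) (hρs : 0 < ρ θs) {C δ κ t : ℝ} (hC : 0 ≤ C)
    (hM : ∀ θ ∈ Theta d, ρ θ ≤ Real.exp (C * d) * ρ θs) (hδ0 : 0 ≤ δ)
    (hδ : delta01 n ρ θs s ≤ ENNReal.ofReal δ) (hδs : δ * s ≤ √n)
    (hκ : 2 * Real.exp ((C + 1) * d) * (Real.exp (-(s ^ 2 * d / 32) / 2) * 2 ^ d) ≤ κ)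
    (hκ1 : κ < 1) (ht : 0 < t) :
    IsProbabilityMeasure (posterior n ρ N) ∧ IsUniqueMLE n N (empirical n N) ∧
      tvDist (posterior n ρ N) (gammaStar n θs (empirical n N)) ≤
        (t + (Real.exp ((4 * s ^ 2 * (d / √(n * thetaMin θs)) + δ / √n) ^ 2) / (1 - κ)
          - 1 + 2 * κ) / t) / 2 + κ := by
  have hn' : (0 : ℝ) < n := by exact_mod_cast hn
  have hq0 := chiSq_nonneg hθs (empirical n N - θs)
  have hmem : empirical n N ∈ Theta d := mem_Theta_of_chiSq_le hθs (by linarith)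
  have hUm := (isClosed_nbhd hθs hn hs.le).measurableSet
  set U := nbhd n θs s with hU
  have hUΘ : ∀ x ∈ U, x ∈ Theta d := fun x hx =>
    mem_Theta_of_chiSq_le hθs (((mem_nbhd_iff hθs hn hs.le x).1 hx).trans hsmall)
  set κ₀ := Real.exp (-(s ^ 2 * d / 32) / 2) * 2 ^ d with hκ₀
  have hκ₀0 : 0 < κ₀ := by positivity
  have hexp1 : 1 ≤ Real.exp ((C + 1) * d) := Real.one_le_exp (by positivity)
  have hκ₀le : 2 * κ₀ ≤ κ := le_trans (by nlinarith) hκ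
  set w₀ : EuclideanSpace ℝ (Fin d) → ℝ := fun θ => likelihoodOn N θ * ρ θ with hw₀
  have hw₀m : Measurable w₀ := (measurable_likelihoodOn N).mul hρm
  have hw₀0 : ∀ θ, 0 ≤ w₀ θ := fun θ => mul_nonneg (likelihoodOn_nonneg N θ) (hρ0 θ)
  have hw₀U : ∀ θ ∈ U, Real.exp (-d) * ρ θs * likelihoodOn N θ ≤ w₀ θ := fun θ hθ => by
    rw [mul_comm]
    exact mul_le_mul_of_nonneg_left (exp_neg_mul_prior_le hθs hd hn hs hδ0 hδ hδs hθ)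
      (likelihoodOn_nonneg N θ)
  have hw₀M : ∀ θ, w₀ θ ≤ Real.exp (C * d) * ρ θs * likelihoodOn N θ := fun θ => by
    by_cases hθ : θ ∈ Theta d
    · rw [mul_comm (Real.exp (C * d) * ρ θs)]
      exact mul_le_mul_of_nonneg_left (hM θ hθ) (likelihoodOn_nonneg N θ)
    · simp [hw₀, likelihoodOn, hθ]
  have hLfin := lintegral_likelihoodOn_ne_top (d := d) N
  have hLtail := setLIntegral_likelihoodOn_le hθs hd hn hN hs hsmall hhat
  -- The prior is at most `e^(Cd) ρ(θ*)` on the parameter space and at least `e^(-d) ρ(θ*)` on `U`,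
  -- which multiplies the likelihood tail by `e^((C+1)d)`. The factor two arises since `U` holds at
  -- least half of the likelihood mass.
  have htail := setLIntegral_compl_le_of_comparable hUm hκ₀0.le (by linarith)
    (by positivity) (by positivity) (fun x _ => hw₀M x) hw₀U hLfin hLtail
  have hκeq : 2 * (Real.exp (C * d) * ρ θs) * κ₀ / (Real.exp (-d) * ρ θs)
      = 2 * Real.exp ((C + 1) * d) * κ₀ := by
    rw [add_mul, one_mul, Real.exp_add, Real.exp_neg]
    field_simp
  rw [hκeq] at htail
  set P := ∫⁻ θ, ENNReal.ofReal (w₀ θ) with hP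
  have hPuniv : unnormPosterior n ρ N Set.univ = P := by
    rw [unnormPosterior_eq hn, withDensity_apply _ .univ, setLIntegral_univ]
  have hPt : P ≠ ⊤ := by
    refine ne_top_of_le_ne_top (ENNReal.mul_ne_top (ENNReal.ofReal_ne_top
      (r := Real.exp (C * d) * ρ θs)) hLfin) ?_
    rw [← lintegral_const_mul' _ _ ENNReal.ofReal_ne_top]
    refine lintegral_mono fun θ => ?_
    rw [← ENNReal.ofReal_mul (by positivity)]
    exact ENNReal.ofReal_le_ofReal (hw₀M θ)
  have hwpos : ∀ θ ∈ U, 0 < w₀ θ := fun θ hθ => by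
    refine lt_of_lt_of_le ?_ (hw₀U θ hθ)
    have : likelihoodOn N θ = likelihood N θ := Set.indicator_of_mem (hUΘ θ hθ) _
    rw [this]
    have := likelihood_pos (hUΘ θ hθ) N
    positivity
  -- The unnormalized density is positive on `U`, so a zero integral would make the likelihood
  -- integrate to zero over `U`, contradicting the tail bound with `κ₀ < 1`.
  have hP0 : P ≠ 0 := by
    intro h0
    have hz : (fun θ => ENNReal.ofReal (w₀ θ)) =ᵐ[volume] 0 :=
      (lintegral_eq_zero_iff hw₀m.ennreal_ofReal).1 h0
    have hLz : ∫⁻ θ in U, ENNReal.ofReal (likelihoodOn N θ) = 0 := by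
      rw [← nonpos_iff_eq_zero, ← lintegral_zero (μ := volume.restrict U)]
      refine lintegral_mono_ae ?_
      filter_upwards [ae_restrict_of_ae hz, ae_restrict_mem hUm] with θ h1 h2
      have := hwpos θ h2
      simp only [Pi.zero_apply, ENNReal.ofReal_eq_zero] at h1
      linarith
    have hLpos := lintegral_likelihoodOn_pos N ⟨θs, hθs⟩
    have hadd := lintegral_add_compl (μ := volume)
      (fun θ => ENNReal.ofReal (likelihoodOn N θ)) hUm
    rw [hLz, zero_add] at hadd
    rw [hadd] at hLtail
    have hlt : ENNReal.ofReal κ₀ * ∫⁻ θ, ENNReal.ofReal (likelihoodOn N θ)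
        < 1 * ∫⁻ θ, ENNReal.ofReal (likelihoodOn N θ) :=
      ENNReal.mul_lt_mul_left hLpos.ne' hLfin (by simp; linarith)
    rw [one_mul] at hlt
    exact absurd hLtail (not_le.2 hlt)
  have hprob : IsProbabilityMeasure (posterior n ρ N) := by
    constructor
    rw [posterior, hPuniv, Measure.smul_apply, hPuniv, smul_eq_mul, ENNReal.inv_mul_cancel hP0 hPt]
  refine ⟨hprob, isUniqueMLE_empirical hn hN hmem, ?_⟩
  obtain ⟨k, hk, hγ⟩ := gaussian_density hθs hn (empirical n N)
  have hγprob : IsProbabilityMeasure (gammaStar n θs (empirical n N)) := by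
    rw [gammaStar]; infer_instance
  have hPr : 0 < P.toReal := ENNReal.toReal_pos hP0 hPt
  have hcont := continuous_chiSq θs
  have hπ : posterior n ρ N
      = volume.withDensity fun θ => ENNReal.ofReal (P.toReal⁻¹ * w₀ θ) := by
    rw [posterior, hPuniv, unnormPosterior_eq hn, ← withDensity_smul _ hw₀m.ennreal_ofReal]
    congr 1
    ext θ
    rw [ENNReal.ofReal_mul (by positivity), ENNReal.ofReal_inv_of_pos hPr, ENNReal.ofReal_toReal hPt]
    rfl
  refine tvDist_le_of_midpoint (U := U)
    (g := fun x => k * Real.exp (-(n * chiSq θs (x - empirical n N)) / 2))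
    (w := fun θ => P.toReal⁻¹ * w₀ θ) (by fun_prop) (by fun_prop) (fun x => by positivity)
    (fun x => mul_nonneg (by positivity) (hw₀0 x)) hUm
    (fun x hx => mul_pos (by positivity) (hwpos x hx)) hγ hπ ?_ (by linarith) hκ1 ?_ ?_ ht
  · intro x hx y hy
    have hw₀e : ∀ z ∈ U, w₀ z = Real.exp (Real.log (likelihood N z) + Real.log (ρ z)) := by
      intro z hz
      rw [Real.exp_add, Real.exp_log (likelihood_pos (hUΘ z hz) N),
        Real.exp_log (prior_of_delta01_le hδ hz).2.1]
      simp only [hw₀, likelihoodOn, Set.indicator_of_mem (hUΘ z hz)]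
    have hosc := log_posterior_oscillation hθs hn hN hs hsmall (by linarith) hδ0 hδ hx hy
    rw [hw₀e x hx, hw₀e y hy]
    have hsq : ∀ a : ℝ, (k * Real.exp (-a / 2)) ^ 2 = k ^ 2 * Real.exp (-a) := fun a => by
      rw [mul_pow, ← Real.exp_nat_mul]; congr 2; push_cast; ring
    rw [hsq, hsq]
    generalize Real.log (likelihood N x) + Real.log (ρ x) = LX at hosc ⊢
    generalize Real.log (likelihood N y) + Real.log (ρ y) = LY at hosc ⊢
    generalize (4 * s ^ 2 * (d / √(n * thetaMin θs)) + δ / √n) ^ 2 = η at hosc ⊢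
    calc P.toReal⁻¹ * Real.exp LX * (k ^ 2 * Real.exp (-(n * chiSq θs (y - empirical n N))))
        = P.toReal⁻¹ * k ^ 2 * Real.exp (LX + -(n * chiSq θs (y - empirical n N))) := by
          rw [Real.exp_add]; ring
      _ ≤ P.toReal⁻¹ * k ^ 2 * Real.exp (η + LY
          + -(n * chiSq θs ((1 / 2 : ℝ) • (x + y) - empirical n N))) := by
          exact mul_le_mul_of_nonneg_left (Real.exp_le_exp.2 (by linarith)) (by positivity)
      _ = _ := by rw [Real.exp_add, Real.exp_add]; ring
  · rw [posterior, hPuniv, unnormPosterior_eq hn, Measure.smul_apply,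
      withDensity_apply _ hUm.compl, smul_eq_mul, mul_comm, ← div_eq_mul_inv]
    refine ENNReal.div_le_of_le_mul (htail.trans ?_)
    exact mul_le_mul' (ENNReal.ofReal_le_ofReal hκ) (setLIntegral_le_lintegral _ _)
  · exact (gammaStar_compl_le hθs hn hs.le hhat).trans
      (ENNReal.ofReal_le_ofReal (by linarith))

end Deterministic

/-! ### Choice of constants and the limit -/

lemma prior_le_of_M0_le (hd : 0 < d) {ρ : EuclideanSpace ℝ (Fin d) → ℝ}
    {θs : EuclideanSpace ℝ (Fin d)} (hθs : θs ∈ Theta d) (hρs : 0 < ρ θs) {C : ℝ}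
    (hM : M0 ρ θs ≤ (C : EReal)) {θ : EuclideanSpace ℝ (Fin d)} (hθ : θ ∈ Theta d) :
    ρ θ ≤ Real.exp (C * d) * ρ θs := by
  have hd' : (0 : ℝ) < d := by exact_mod_cast hd
  rw [M0] at hM
  set S := ⨆ θ ∈ Theta d, ENNReal.ofReal (ρ θ / ρ θs) with hS
  have hle : ∀ θ ∈ Theta d, ENNReal.ofReal (ρ θ / ρ θs) ≤ S := fun θ hθ =>
    le_iSup₂ (f := fun θ (_ : θ ∈ Theta d) => ENNReal.ofReal (ρ θ / ρ θs)) θ hθ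
  have hS1 : 1 ≤ S := by simpa [div_self hρs.ne'] using hle θs hθs
  have hSt : S ≠ ⊤ := by
    intro h
    rw [h, ENNReal.log_top, EReal.coe_mul_top_of_pos (by positivity)] at hM
    simp at hM
  have hSr : 0 < S.toReal := ENNReal.toReal_pos (by positivity) hSt
  rw [← ENNReal.ofReal_toReal hSt, ENNReal.log_ofReal_of_pos hSr, ← EReal.coe_mul,
    EReal.coe_le_coe_iff, inv_mul_le_iff₀ hd', Real.log_le_iff_le_exp hSr] at hM
  have h1 := hle θ hθ
  rw [← ENNReal.ofReal_toReal hSt, ENNReal.ofReal_le_ofReal_iff hSr.le, div_le_iff₀ hρs] at h1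
  rw [mul_comm C]
  exact h1.trans (by gcongr)

lemma total_error_le {ε κ E : ℝ} (hε : 0 < ε) (hε1 : ε ≤ 1) (hκ : κ = ε ^ 2 / 16)
    (hE : E ≤ 1 + κ) : (ε + (E / (1 - κ) - 1 + 2 * κ) / ε) / 2 + κ ≤ ε := by
  have hκ0 : 0 < κ := by rw [hκ]; positivity
  have hκ1 : κ ≤ 1 / 16 := by rw [hκ]; nlinarith
  have h1 : E / (1 - κ) ≤ 1 + 3 * κ := by
    rw [div_le_iff₀ (by linarith)]
    nlinarith
  have h2 : (E / (1 - κ) - 1 + 2 * κ) / ε ≤ 5 * ε / 16 := by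
    rw [div_le_iff₀ hε]
    nlinarith
  nlinarith

end PmfBvM

open PmfBvM in
theorem corollary5p6
    (d : ℕ → ℕ) (hd : ∀ n, 1 ≤ d n)
    (θs : ∀ n, EuclideanSpace ℝ (Fin (d n))) (hθs : ∀ n, θs n ∈ PmfBvM.Theta (d n))
    (ρ : ∀ n, EuclideanSpace ℝ (Fin (d n)) → ℝ)
    (hρ_meas : ∀ n, Measurable (ρ n)) (hρ_nonneg : ∀ n θ, 0 ≤ ρ n θ)
    (hρ_pos : ∀ n, 0 < ρ n (θs n))
    (hM0 : ∃ C : ℝ, ∀ᶠ n in atTop, PmfBvM.M0 (ρ n) (θs n) ≤ (C : EReal))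
    (hdelta : ∀ s : ℝ, 0 ≤ s →
      Tendsto (fun n : ℕ => PmfBvM.delta01 n (ρ n) (θs n) s / ENNReal.ofReal (√(n : ℝ)))
        atTop (𝓝 0))
    (hdim : Tendsto (fun n : ℕ => (d n : ℝ) ^ 2 / (n * PmfBvM.thetaMin (θs n))) atTop (𝓝 0)) :
    ∀ ε : ℝ, 0 < ε →
      Tendsto
        (fun n : ℕ => PmfBvM.multinomial n (θs n)
          {N | IsProbabilityMeasure (PmfBvM.posterior n (ρ n) N) ∧
            ∃ θh, PmfBvM.IsUniqueMLE n N θh ∧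
              PmfBvM.tvDist (PmfBvM.posterior n (ρ n) N)
                (PmfBvM.gammaStar n (θs n) θh) ≤ ε})
        atTop (𝓝 1) := by
  intro ε₀ hε₀
  have hprob : ∀ n, IsProbabilityMeasure (multinomial n (θs n)) := fun n => by
    have := isProbabilityMeasure_categorical (hθs n)
    exact Measure.isProbabilityMeasure_map Measurable.of_discrete.aemeasurable
  refine tendsto_order.2 ⟨fun a ha => ?_, fun b hb => .of_forall fun n => prob_le_one.trans_lt hb⟩
  obtain ⟨C₀, hC₀⟩ := hM0
  -- `K` is chosen so that the exceptional probability `1/K²` is half of `1 - a`.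
  obtain ⟨K, hK, hKa⟩ : ∃ K : ℝ, 0 < K ∧ a < 1 - ENNReal.ofReal (1 / K ^ 2) := by
    have hat : a ≠ ⊤ := ne_top_of_lt ha
    have ha1 : a.toReal < 1 := by simpa using (ENNReal.toReal_lt_toReal hat ENNReal.one_ne_top).2 ha
    have ha0 : 0 ≤ a.toReal := ENNReal.toReal_nonneg
    have hpos : 0 < 2 / (1 - a.toReal) := div_pos two_pos (by linarith)
    refine ⟨√(2 / (1 - a.toReal)), by positivity, ?_⟩
    rw [Real.sq_sqrt hpos.le, one_div_div, ← ENNReal.ofReal_one,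
      ← ENNReal.ofReal_sub _ (by linarith)]
    conv_lhs => rw [← ENNReal.ofReal_toReal hat]
    rw [ENNReal.ofReal_lt_ofReal_iff (by linarith)]
    linarith
  set ε := min ε₀ 1 with hε
  have hε0 : 0 < ε := lt_min hε₀ one_pos
  set κ := ε ^ 2 / 16 with hκ
  have hκ0 : 0 < κ := by positivity
  have hκ1 : κ < 1 := by
    have : ε ≤ 1 := min_le_right _ _
    rw [hκ]; nlinarith
  set C := max C₀ 0 with hC
  have hCnn : 0 ≤ C := le_max_right _ _
  set B := Real.log (2 / κ) with hB
  have hB0 : 0 < B := Real.log_pos (by rw [one_lt_div hκ0]; linarith)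
  -- The `64` matches the tail exponent `s² d / 64`: it beats `C + 1` from the prior and one more
  -- from `2^d ≤ e^d`, leaving `2 e^(-B) = κ`. The `4K²` puts the estimator within half the radius.
  set s := √(64 * (C + 2 + B) + 4 * K ^ 2) with hs
  have hs2 : s ^ 2 = 64 * (C + 2 + B) + 4 * K ^ 2 := Real.sq_sqrt (by positivity)
  have hs0 : 0 < s := by positivity
  set v := √(Real.log (1 + κ)) with hv
  have hlog0 : 0 < Real.log (1 + κ) := Real.log_pos (by linarith)
  have hv0 : 0 < v := Real.sqrt_pos.2 hlog0
  -- `τ` bounds both `d/√(n θmin)` and `δ/√n`. The first entry gives `E ≤ (4s² + 1)τ ≤ v`, hence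
  -- `e^(E²) ≤ 1 + κ`; the second gives `δ s ≤ √n`.
  set τ := min (v / (4 * s ^ 2 + 1)) (1 / s) with hτ
  have hτ0 : 0 < τ := by positivity
  have hev1 : ∀ᶠ n : ℕ in atTop, (d n : ℝ) ^ 2 / (n * thetaMin (θs n)) < min (τ ^ 2)
      (1 / (25 * s ^ 2)) := hdim.eventually_lt_const (by positivity)
  have hev2 : ∀ᶠ n : ℕ in atTop,
      delta01 n (ρ n) (θs n) s / ENNReal.ofReal (√(n : ℝ)) < ENNReal.ofReal τ :=
    (hdelta s hs0.le).eventually_lt_const (by simpa using hτ0)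
  filter_upwards [hev1, hev2, hC₀, eventually_gt_atTop 0] with n h1 h2 h3 hn
  refine hKa.trans_le ((one_sub_le_multinomial (hθs n) hn (hd n) hK).trans (measure_mono ?_))
  rintro N ⟨hN, hchi⟩
  have hn' : (0 : ℝ) < n := by exact_mod_cast hn
  have hd' : (1 : ℝ) ≤ d n := by exact_mod_cast hd n
  have hm := thetaMin_pos (hθs n)
  have hsn : 0 < √(n : ℝ) := Real.sqrt_pos.2 hn'
  have hsmall : s ^ 2 * (d n / n) ≤ thetaMin (θs n) / 25 := by
    have h4 := (h1.trans_le (min_le_right _ _)).le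
    rw [div_le_div_iff₀ (by positivity) (by positivity)] at h4
    rw [← mul_div_assoc, div_le_div_iff₀ hn' (by norm_num)]
    -- The hypothesis controls `d²`, and `d ≤ d²` because `d ≥ 1`.
    nlinarith [mul_le_mul_of_nonneg_left hd' (by positivity : 0 ≤ s ^ 2 * (d n : ℝ))]
  have hchi' : chiSq (θs n) (empirical n N - θs n) ≤ K ^ 2 * (d n / n) := by
    rw [chiSq_sub]
    simpa only [fullPmf_empirical hn hN] using hchi
  have hhat : 4 * chiSq (θs n) (empirical n N - θs n) ≤ s ^ 2 * (d n / n) := by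
    have h5 : 4 * K ^ 2 * ((d n : ℝ) / n) ≤ s ^ 2 * (d n / n) := by
      gcongr
      rw [hs2]
      nlinarith
    linarith
  have hM : ∀ θ ∈ Theta (d n), ρ n θ ≤ Real.exp (C * d n) * ρ n (θs n) := fun θ hθ =>
    prior_le_of_M0_le (hd n) (hθs n) (hρ_pos n)
      (h3.trans (EReal.coe_le_coe_iff.2 (le_max_left _ _))) hθ
  have hδ : delta01 n (ρ n) (θs n) s ≤ ENNReal.ofReal (τ * √n) := by
    rw [ENNReal.ofReal_mul hτ0.le]
    exact (ENNReal.div_le_iff_le_mul (.inl (by simpa using hn')) (.inl ENNReal.ofReal_ne_top)).1 h2.le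
  have hδs : τ * √n * s ≤ √n := by
    have h6 : τ * s ≤ 1 := by
      rw [← le_div_iff₀ hs0]; exact min_le_right _ _
    nlinarith
  have hκle : 2 * Real.exp ((C + 1) * d n) * (Real.exp (-(s ^ 2 * d n / 32) / 2) * 2 ^ d n) ≤ κ := by
    have h7 : (2 : ℝ) ^ d n ≤ Real.exp (d n) := by
      rw [← mul_one (d n : ℝ), Real.exp_nat_mul]
      gcongr
      have := Real.add_one_le_exp 1
      linarith
    calc 2 * Real.exp ((C + 1) * d n) * (Real.exp (-(s ^ 2 * d n / 32) / 2) * 2 ^ d n)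
        ≤ 2 * Real.exp ((C + 1) * d n) * (Real.exp (-(s ^ 2 * d n / 32) / 2)
          * Real.exp (d n)) := by gcongr
      _ = 2 * Real.exp (((C + 1) - s ^ 2 / 64 + 1) * d n) := by
          rw [mul_assoc, ← Real.exp_add, ← Real.exp_add]; ring_nf
      _ ≤ 2 * Real.exp (-B) := by
          gcongr
          rw [hs2]
          nlinarith [sq_nonneg K]
      _ = κ := by
          rw [Real.exp_neg, hB, Real.exp_log (by positivity)]; field_simp
  obtain ⟨hp, hmle, htv⟩ := tvDist_posterior_le (hθs n) (hd n) hn hN hs0 hsmall hhat (hρ_meas n)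
    (hρ_nonneg n) (hρ_pos n) hCnn hM (by positivity) hδ hδs hκle hκ1 hε0
  refine ⟨hp, empirical n N, hmle, htv.trans ((total_error_le hε0 (min_le_right _ _) hκ ?_).trans
    (min_le_left _ _))⟩
  have h8 : (d n : ℝ) / √(n * thetaMin (θs n)) ≤ τ := by
    refine abs_le_of_sq_le_sq' ?_ hτ0.le |>.2
    rw [div_pow, Real.sq_sqrt (by positivity)]
    exact (h1.trans_le (min_le_left _ _)).le
  rw [mul_div_cancel_right₀ _ hsn.ne']
  calc Real.exp ((4 * s ^ 2 * (d n / √(n * thetaMin (θs n))) + τ) ^ 2)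
      ≤ Real.exp (v ^ 2) := by
        have h9 : 4 * s ^ 2 * (d n / √(n * thetaMin (θs n))) + τ ≤ v := by
          calc 4 * s ^ 2 * (d n / √(n * thetaMin (θs n))) + τ ≤ 4 * s ^ 2 * τ + τ := by gcongr
            _ = τ * (4 * s ^ 2 + 1) := by ring
            _ ≤ v := by rw [← le_div_iff₀ (by positivity)]; exact min_le_left _ _
        gcongr
    _ = 1 + κ := by rw [hv, Real.sq_sqrt hlog0.le, Real.exp_log (by linarith)]
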